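/- Let $\mathcal S\subset\mathbb R^k$ be a compact set and let $G_{\rm left}:\mathcal S\to\mathbb C^{p\times m}$, $G_{\rm right}:\mathcal S\to\mathbb C^{m\times q}$ be continuously differentiable. Let $\mathbb M$ be the real Hilbert space of square integrable Hermitian $m\times m$ matrix-valued functions on $\mathcal S$ (with Lebesgue measure), and let $\mathfrak M$ and $\mathfrak M_+$ be the cones of those $\rho\in\mathbb M$ with $\rho(\theta)\ge0$, respectively $\rho(\theta)>0$, for all $\theta\in\mathcal S$. Let $L(\rho)=\int_{\mathcal S}G_{\rm left}\,\rho\,G_{\rm right}\,d\theta$ for $\rho\in\mathbb M$, and let $\mathfrak R\subseteq\mathbb C^{p\times q}$ be the range of $L$, a real vector space with inner product $\langle\lambda,R\rangle={\rm Re}\,{\rm trace}(\lambda^*R)$ and the corresponding norm. Let $\mathcal K=\overline{L(\mathfrak M)}$, with ${\rm int}(\mathcal K)$ its interior in $\mathfrak R$, and for $R\in\mathfrak R$ let $\mathfrak M_{R,+}=\{\rho\in\mathfrak M_+:L(\rho)=R\}$. For $\lambda\in\mathfrak R$ put $L^*(\lambda)=\frac12(N+N^*)$ with $N=G_{\rm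 left}^*\lambda G_{\rm right}^*$, $\kappa(\lambda)=L\left(\frac1e\exp(-L^*(\lambda))\right)$ and $$\nabla\kappa|_\lambda:\mathfrak R\to\mathfrak R,\quad \delta\mapsto-\tfrac1e\,L\left(M_{\exp(-L^*(\lambda))}(L^*(\delta))\right),\qquad M_C(\Delta)=\int_0^1C^{1-\tau}\Delta\,C^{\tau}\,d\tau .$$ For $\rho\in\mathfrak M_+$ let $\mathbb S(\rho\|I)=\int_{\mathcal S}{\rm trace}(\rho\log\rho)\,d\theta$; this integral converges absolutely. For every $\lambda\in\mathfrak R$, $\nabla\kappa|_\lambda$ is invertible and is the derivative of $\kappa$ at $\lambda$. Let $R\in\mathfrak R$ and consider the differential equation $$\frac{d}{dt}\lambda_t=\left(\nabla\kappa|_{\lambda_t}\right)^{-1}\left(R-\kappa(\lambda_t)\right).\qquad(*)$$ 1. Suppose $R\in{\rm int}(\mathcal K)$. Then $\mathbb S(\rho\|I)$ has a minimum over $\rho\in\mathfrak M_{R,+}$; the minimizer is unique (up to equality almost everywhere on $\mathcal S$) and has the form $\rho=\frac1e\exp(-L^*(\hat\lambda))$ for some $\hat\lambda\in\mathfrak R$.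 For every $\lambda_0\in\mathfrak R$, the equation $(*)$ has a unique solution with initial value $\lambda_0$; it exists for all $t\in[0,\infty)$, remains bounded and converges to $\hat\lambda$ as $t\to\infty$. The convergence is exponential: $\|\lambda_t-\hat\lambda\|\le Ce^{-t}$ for all $t\ge0$, for some constant $C$ (which may depend on $\lambda_0$), and $V(\lambda_t)=\|R-\kappa(\lambda_t)\|^2$ satisfies $\frac{d}{dt}V(\lambda_t)=-2V(\lambda_t)$ for all $t\ge0$. 2. Conversely, suppose $R\notin{\rm int}(\mathcal K)$. Then $(*)$ diverges: for every $\lambda_0\in\mathfrak R$ there is a unique maximal solution with initial value $\lambda_0$, defined on an interval $[0,T)$ with $0<T\le\infty$, and $\|\lambda_t\|\to\infty$ as $t\to T$. -/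

import Mathlib

open MeasureTheory Set Filter Topology
open scoped Matrix ComplexOrder

-- Matrices carry the Frobenius norm, i.e. the norm of `⟨A, B⟩ = Re trace (Aᴴ B)`.
attribute [local instance] Matrix.frobeniusNormedAddCommGroup Matrix.frobeniusNormedSpace

noncomputable section

/-! ### Matrix calculus -/

/-- The Hermitian part `(M + Mᴴ) / 2`. -/
def hermPart {m : ℕ} (M : Matrix (Fin m) (Fin m) ℂ) : Matrix (Fin m) (Fin m) ℂ :=
  (1 / 2 : ℝ) • (M + Mᴴ)

/-- The non-commutative multiplication `M_C : Δ ↦ ∫₀¹ C^(1-τ) Δ C^τ dτ`, entry by entry; real powers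
of the Hermitian matrix `C` are taken in the functional calculus. -/
def scrambledMul {m : ℕ} (C D : Matrix (Fin m) (Fin m) ℂ) : Matrix (Fin m) (Fin m) ℂ :=
  Matrix.of fun i j => ∫ τ in (0 : ℝ)..1,
    (cfc (fun x : ℝ => x ^ (1 - τ)) C * D * cfc (fun x : ℝ => x ^ τ) C) i j

theorem hermPart_isHermitian {m : ℕ} (M : Matrix (Fin m) (Fin m) ℂ) :
    (hermPart M).IsHermitian := by
  unfold hermPart Matrix.IsHermitian
  rw [Matrix.conjTranspose_smul, Matrix.conjTranspose_add, Matrix.conjTranspose_conjTranspose,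
    add_comm]
  simp

theorem continuous_matrix_exp {m : ℕ} :
    Continuous (fun A : Matrix (Fin m) (Fin m) ℂ => NormedSpace.exp A) := by
  let _ : NormedRing (Matrix (Fin m) (Fin m) ℂ) := Matrix.frobeniusNormedRing
  let _ : NormedAlgebra ℝ (Matrix (Fin m) (Fin m) ℂ) := Matrix.frobeniusNormedAlgebra
  let _ : NormedAlgebra ℚ (Matrix (Fin m) (Fin m) ℂ) := NormedAlgebra.restrictScalars ℚ ℝ _
  exact NormedSpace.exp_continuous

theorem cfc_exp_eq {m : ℕ} {A : Matrix (Fin m) (Fin m) ℂ} (hA : A.IsHermitian) :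
    cfc Real.exp A = NormedSpace.exp A := by
  conv_rhs => rw [hA.spectral_theorem]
  rw [hA.cfc_eq, Matrix.IsHermitian.cfc, Unitary.conjStarAlgAut_apply,
    Unitary.conjStarAlgAut_apply]
  have h := Matrix.exp_units_conj (Unitary.toUnits hA.eigenvectorUnitary)
    (Matrix.diagonal (RCLike.ofReal ∘ hA.eigenvalues : Fin m → ℂ))
  rw [Matrix.exp_diagonal] at h
  refine Eq.trans ?_ h.symm
  congr 3
  funext i
  rw [Pi.coe_exp]
  simp [← Complex.exp_eq_exp_ℂ]

theorem cfc_rpow_exp {m : ℕ} {A : Matrix (Fin m) (Fin m) ℂ} (hA : A.IsHermitian) (τ : ℝ) :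
    cfc (fun x : ℝ => x ^ τ) (NormedSpace.exp A) = NormedSpace.exp (τ • A) := by
  have hsa : IsSelfAdjoint A := hA
  have hh : (τ • A).IsHermitian := by
    rw [Matrix.IsHermitian, Matrix.conjTranspose_smul, hA, star_trivial]
  rw [← cfc_exp_eq hA, ← cfc_exp_eq hh,
    ← cfc_comp' (fun x : ℝ => x ^ τ) Real.exp A
      (Set.Finite.continuousOn (Set.Finite.image _ Matrix.finite_real_spectrum) _)
      Real.continuous_exp.continuousOn,
    ← cfc_comp_smul τ Real.exp A Real.continuous_exp.continuousOn]
  refine cfc_congr fun x _ => ?_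
  simp only [smul_eq_mul]
  rw [← Real.exp_mul, mul_comm]

theorem scrambledMul_exp {m : ℕ} {A : Matrix (Fin m) (Fin m) ℂ} (hA : A.IsHermitian)
    (D : Matrix (Fin m) (Fin m) ℂ) :
    scrambledMul (NormedSpace.exp A) D = Matrix.of fun i j => ∫ τ in (0 : ℝ)..1,
      (NormedSpace.exp ((1 - τ) • A) * D * NormedSpace.exp (τ • A)) i j := by
  simp only [scrambledMul, cfc_rpow_exp hA]

theorem continuous_scrambled_integrand {m : ℕ} {X : Type*} [TopologicalSpace X]
    {A D : X → Matrix (Fin m) (Fin m) ℂ} (hA : Continuous A) (hD : Continuous D) (i j : Fin m) :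
    Continuous fun z : X × ℝ =>
      (NormedSpace.exp ((1 - z.2) • A z.1) * D z.1 * NormedSpace.exp (z.2 • A z.1)) i j := by
  have h1 : Continuous fun z : X × ℝ => NormedSpace.exp ((1 - z.2) • A z.1) :=
    continuous_matrix_exp.comp (by fun_prop)
  have h2 : Continuous fun z : X × ℝ => NormedSpace.exp (z.2 • A z.1) :=
    continuous_matrix_exp.comp (by fun_prop)
  exact ((h1.matrix_mul (hD.comp continuous_fst)).matrix_mul h2).matrix_elem i j

theorem scrambledMul_exp_add {m : ℕ} {A : Matrix (Fin m) (Fin m) ℂ} (hA : A.IsHermitian)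
    (D E : Matrix (Fin m) (Fin m) ℂ) :
    scrambledMul (NormedSpace.exp A) (D + E) =
      scrambledMul (NormedSpace.exp A) D + scrambledMul (NormedSpace.exp A) E := by
  have hc : ∀ (D : Matrix (Fin m) (Fin m) ℂ) (i j : Fin m), IntervalIntegrable (fun τ : ℝ =>
      (NormedSpace.exp ((1 - τ) • A) * D * NormedSpace.exp (τ • A)) i j) volume 0 1 :=
    fun D i j => ((continuous_scrambled_integrand (X := Unit) (A := fun _ => A) (D := fun _ => D)
      continuous_const continuous_const i j).comp
        (g := fun z => _) (f := fun τ : ℝ => ((), τ)) (by fun_prop)).intervalIntegrable _ _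
  ext i j
  simp only [scrambledMul_exp hA, Matrix.of_apply, Matrix.add_apply]
  rw [← intervalIntegral.integral_add (hc D i j) (hc E i j)]
  simp only [Matrix.mul_add, Matrix.add_mul, Matrix.add_apply]

theorem scrambledMul_smul {m : ℕ} (C : Matrix (Fin m) (Fin m) ℂ) (c : ℝ)
    (D : Matrix (Fin m) (Fin m) ℂ) : scrambledMul C (c • D) = c • scrambledMul C D := by
  ext i j
  simp only [scrambledMul, Matrix.of_apply, Matrix.smul_apply]
  rw [← intervalIntegral.integral_smul]
  simp only [Matrix.mul_smul, Matrix.smul_mul, Matrix.smul_apply]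

theorem scrambledMul_exp_isHermitian {m : ℕ} {A D : Matrix (Fin m) (Fin m) ℂ}
    (hA : A.IsHermitian) (hD : D.IsHermitian) :
    (scrambledMul (NormedSpace.exp A) D).IsHermitian := by
  have hs : ∀ τ : ℝ, (NormedSpace.exp (τ • A))ᴴ = NormedSpace.exp (τ • A) := fun τ => by
    rw [← Matrix.exp_conjTranspose, Matrix.conjTranspose_smul, hA]; simp
  have he : ∀ (τ : ℝ) (i j : Fin m),
      star ((NormedSpace.exp ((1 - τ) • A) * D * NormedSpace.exp (τ • A)) j i) =
        (NormedSpace.exp (τ • A) * D * NormedSpace.exp ((1 - τ) • A)) i j := fun τ i j => by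
    rw [← Matrix.conjTranspose_apply, Matrix.conjTranspose_mul, Matrix.conjTranspose_mul, hs, hs,
      hD.eq, Matrix.mul_assoc]
  rw [scrambledMul_exp hA]
  ext i j
  rw [Matrix.conjTranspose_apply, Matrix.of_apply, Matrix.of_apply]
  have h1 := intervalIntegral.integral_comp_sub_left (a := 0) (b := 1) (fun τ : ℝ =>
    (NormedSpace.exp ((1 - τ) • A) * D * NormedSpace.exp (τ • A)) i j) 1
  simp only [sub_self, sub_zero, sub_sub_cancel] at h1
  rw [← h1]
  simp only [← he]
  rw [intervalIntegral.integral_of_le zero_le_one, intervalIntegral.integral_of_le zero_le_one]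
  exact (integral_conj (𝕜 := ℂ)).symm

/-! ### The moment problem -/

/-- The data of a moment problem: a compact support set `S ⊆ ℝᵏ` and integration kernels
`Gl : S → ℂ^{p × m}`, `Gr : S → ℂ^{m × q}`, continuously differentiable on `S`. -/
structure MomentData (k m p q : ℕ) where
  S : Set (EuclideanSpace ℝ (Fin k))
  isCompact_S : IsCompact S
  Gl : EuclideanSpace ℝ (Fin k) → Matrix (Fin p) (Fin m) ℂ
  Gr : EuclideanSpace ℝ (Fin k) → Matrix (Fin m) (Fin q) ℂ
  contDiffOn_Gl : ∀ i j, ContDiffOn ℝ 1 (fun θ => Gl θ i j) S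
  contDiffOn_Gr : ∀ i j, ContDiffOn ℝ 1 (fun θ => Gr θ i j) S

namespace MomentData

variable {k m p q : ℕ} (P : MomentData k m p q)

/-- The real vector space of square integrable Hermitian `m × m` matrix functions on `S`. -/
def HermL2 : Submodule ℝ (EuclideanSpace ℝ (Fin k) → Matrix (Fin m) (Fin m) ℂ) where
  carrier := {ρ | (∀ i j, MemLp (fun θ => ρ θ i j) 2 (volume.restrict P.S)) ∧
    ∀ θ ∈ P.S, (ρ θ).IsHermitian}
  add_mem' := fun {a b} ha hb =>
    ⟨fun i j => (ha.1 i j).add (hb.1 i j), fun θ hθ => (ha.2 θ hθ).add (hb.2 θ hθ)⟩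
  zero_mem' := ⟨fun _ _ => MemLp.zero, fun _ _ => Matrix.isHermitian_zero⟩
  smul_mem' := fun c a ha => ⟨fun i j => (ha.1 i j).const_smul c, fun θ hθ => by
    have h := ha.2 θ hθ
    simp only [Matrix.IsHermitian, Pi.smul_apply, Matrix.conjTranspose_smul] at h ⊢
    rw [h]; simp⟩

/-- The cone of elements of `HermL2` that are nonnegative definite at every point of `S`. -/
def cone : Set P.HermL2 := {ρ | ∀ θ ∈ P.S, (ρ.1 θ).PosSemidef}

/-- The cone of elements of `HermL2` that are positive definite at every point of `S`. -/
def conePos : Set P.HermL2 := {ρ | ∀ θ ∈ P.S, (ρ.1 θ).PosDef}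

theorem continuousOn_Gl : ContinuousOn P.Gl P.S :=
  continuousOn_pi.2 fun i => continuousOn_pi.2 fun j => (P.contDiffOn_Gl i j).continuousOn

theorem continuousOn_Gr : ContinuousOn P.Gr P.S :=
  continuousOn_pi.2 fun i => continuousOn_pi.2 fun j => (P.contDiffOn_Gr i j).continuousOn

theorem isFiniteMeasure_restrict : IsFiniteMeasure (volume.restrict P.S) :=
  ⟨by simpa using P.isCompact_S.measure_lt_top⟩

theorem memLp_of_continuousOn {f : EuclideanSpace ℝ (Fin k) → ℂ} (hf : ContinuousOn f P.S) :
    MemLp f 2 (volume.restrict P.S) := by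
  have := P.isFiniteMeasure_restrict
  obtain ⟨C, hC⟩ := P.isCompact_S.exists_bound_of_continuousOn hf
  exact MemLp.of_bound (hf.aestronglyMeasurable P.isCompact_S.measurableSet) C
    ((ae_restrict_iff' P.isCompact_S.measurableSet).2 (Eventually.of_forall hC))

theorem mem_HermL2_of_continuousOn {ρ : EuclideanSpace ℝ (Fin k) → Matrix (Fin m) (Fin m) ℂ}
    (hρ : ContinuousOn ρ P.S) (hh : ∀ θ ∈ P.S, (ρ θ).IsHermitian) : ρ ∈ P.HermL2 :=
  ⟨fun i j => P.memLp_of_continuousOn (continuousOn_pi.1 (continuousOn_pi.1 hρ i) j), hh⟩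

theorem integrable_moment (ρ : P.HermL2) (i : Fin p) (j : Fin q) :
    Integrable (fun θ => (P.Gl θ * ρ.1 θ * P.Gr θ) i j) (volume.restrict P.S) := by
  have := P.isFiniteMeasure_restrict
  simp only [Matrix.mul_apply, Finset.sum_mul]
  refine integrable_finsetSum _ fun b _ => integrable_finsetSum _ fun a _ => ?_
  have hρ : Integrable (fun θ => ρ.1 θ a b) (volume.restrict P.S) :=
    (ρ.2.1 a b).integrable (by norm_num)
  have hG : ContinuousOn (fun θ => P.Gl θ i a * P.Gr θ b j) P.S :=
    (P.contDiffOn_Gl i a).continuousOn.mul (P.contDiffOn_Gr b j).continuousOn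
  obtain ⟨C, hC⟩ := P.isCompact_S.exists_bound_of_continuousOn hG
  have := hρ.bdd_mul (hG.aestronglyMeasurable P.isCompact_S.measurableSet)
    ((ae_restrict_iff' P.isCompact_S.measurableSet).2 (Eventually.of_forall hC))
  refine this.congr (Eventually.of_forall fun θ => ?_)
  simp only
  ring

/-- `ρ ↦ ∫_S Gl ρ Gr dθ` (entry by entry) with values in the ambient matrix space. -/
def moment : P.HermL2 →ₗ[ℝ] Matrix (Fin p) (Fin q) ℂ where
  toFun ρ := Matrix.of fun i j => ∫ θ in P.S, (P.Gl θ * ρ.1 θ * P.Gr θ) i j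
  map_add' ρ σ := by
    ext i j
    simp only [Matrix.of_apply, Matrix.add_apply]
    rw [← integral_add (P.integrable_moment ρ i j) (P.integrable_moment σ i j)]
    simp [Matrix.mul_add, Matrix.add_mul]
  map_smul' c ρ := by
    ext i j
    simp only [Matrix.of_apply, Matrix.smul_apply, RingHom.id_apply]
    rw [← integral_smul]
    simp [Matrix.mul_smul, Matrix.smul_mul]

/-- The space `ℜ` of moments: the range of the moment map. -/
def momentSpace : Submodule ℝ (Matrix (Fin p) (Fin q) ℂ) := LinearMap.range P.moment

/-- The moment operator `L`, onto the space of moments. -/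
def L : P.HermL2 →ₗ[ℝ] P.momentSpace := P.moment.rangeRestrict

/-- The closed cone `𝒦` of moments, inside the space of moments. -/
def K : Set P.momentSpace := closure (P.L '' P.cone)

/-- The adjoint `L*`: `λ ↦ (Glᴴ λ Grᴴ)_Herm`. -/
def LStar (lam : P.momentSpace) (θ : EuclideanSpace ℝ (Fin k)) : Matrix (Fin m) (Fin m) ℂ :=
  hermPart ((P.Gl θ)ᴴ * (lam : Matrix (Fin p) (Fin q) ℂ) * (P.Gr θ)ᴴ)

theorem LStar_isHermitian (lam : P.momentSpace) (θ : EuclideanSpace ℝ (Fin k)) :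
    (P.LStar lam θ).IsHermitian := hermPart_isHermitian _

theorem LStar_add (lam mu : P.momentSpace) (θ : EuclideanSpace ℝ (Fin k)) :
    P.LStar (lam + mu) θ = P.LStar lam θ + P.LStar mu θ := by
  simp only [LStar, hermPart, Submodule.coe_add, Matrix.mul_add, Matrix.add_mul,
    Matrix.conjTranspose_add]
  rw [← smul_add]
  congr 1
  abel

theorem LStar_smul (c : ℝ) (lam : P.momentSpace) (θ : EuclideanSpace ℝ (Fin k)) :
    P.LStar (c • lam) θ = c • P.LStar lam θ := by
  simp only [LStar, hermPart, Submodule.coe_smul, Matrix.mul_smul, Matrix.smul_mul,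
    Matrix.conjTranspose_smul, star_trivial]
  rw [← smul_add, smul_comm]

theorem continuous_LStar (lam : P.momentSpace) :
    Continuous fun θ : P.S => P.LStar lam θ := by
  have h1 : Continuous fun θ : P.S => P.Gl θ := P.continuousOn_Gl.domRestrict
  have h2 : Continuous fun θ : P.S => P.Gr θ := P.continuousOn_Gr.domRestrict
  have h3 : Continuous fun θ : P.S =>
      (P.Gl θ)ᴴ * (lam : Matrix (Fin p) (Fin q) ℂ) * (P.Gr θ)ᴴ :=
    (h1.matrix_conjTranspose.matrix_mul continuous_const).matrix_mul h2.matrix_conjTranspose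
  exact (h3.add h3.matrix_conjTranspose).const_smul (1 / 2 : ℝ)

/-- The exponential density `e⁻¹ exp (-L*(λ))`. -/
def rhoExp (lam : P.momentSpace) : P.HermL2 :=
  ⟨fun θ => (Real.exp 1)⁻¹ • NormedSpace.exp (-P.LStar lam θ),
    P.mem_HermL2_of_continuousOn
      (continuousOn_iff_continuous_domRestrict.2
        ((continuous_matrix_exp.comp (P.continuous_LStar lam).neg).const_smul (Real.exp 1)⁻¹))
      fun θ _ => by
        have h := (P.LStar_isHermitian lam θ).neg.exp
        simp only [Matrix.IsHermitian, Matrix.conjTranspose_smul, star_trivial] at h ⊢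
        rw [h]⟩

/-- The map `κ : λ ↦ L (e⁻¹ exp (-L*(λ)))`. -/
def kappa (lam : P.momentSpace) : P.momentSpace := P.L (P.rhoExp lam)

/-- `δ ↦ M_{exp (-L*(λ))} (L*(δ))`, pointwise on `S`. -/
def scrambledLStar (lam : P.momentSpace) : P.momentSpace →ₗ[ℝ] P.HermL2 where
  toFun δ := ⟨fun θ => scrambledMul (NormedSpace.exp (-P.LStar lam θ)) (P.LStar δ θ),
    P.mem_HermL2_of_continuousOn
      (continuousOn_iff_continuous_domRestrict.2 (by
        refine continuous_matrix fun i j => ?_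
        simp only [Set.domRestrict_apply, scrambledMul_exp (P.LStar_isHermitian lam _).neg,
          Matrix.of_apply]
        exact intervalIntegral.continuous_parametric_intervalIntegral_of_continuous'
          (f := fun (θ : P.S) (τ : ℝ) => (NormedSpace.exp ((1 - τ) • -P.LStar lam θ) *
            P.LStar δ θ * NormedSpace.exp (τ • -P.LStar lam θ)) i j)
          (continuous_scrambled_integrand (P.continuous_LStar lam).neg (P.continuous_LStar δ) i j)
          0 1))
      fun θ _ => scrambledMul_exp_isHermitian (P.LStar_isHermitian lam θ).neg
        (P.LStar_isHermitian δ θ)⟩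
  map_add' δ ε := Subtype.ext <| funext fun θ => by
    simp only [Submodule.coe_add, Pi.add_apply, LStar_add]
    exact scrambledMul_exp_add (P.LStar_isHermitian lam θ).neg _ _
  map_smul' c δ := Subtype.ext <| funext fun θ => by
    simp only [Submodule.coe_smul, Pi.smul_apply, LStar_smul, RingHom.id_apply]
    exact scrambledMul_smul _ _ _

/-- The Jacobian `∇κ|_λ : δ ↦ -e⁻¹ L (M_{exp (-L*(λ))} (L*(δ)))`. -/
def nablaKappa (lam : P.momentSpace) : Module.End ℝ P.momentSpace :=
  -((Real.exp 1)⁻¹ • (P.L ∘ₗ P.scrambledLStar lam))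

/-- The integrand `trace (ρ log ρ)` of the entropy functional. -/
def entropyDensity (ρ : P.HermL2) (θ : EuclideanSpace ℝ (Fin k)) : ℝ :=
  (ρ.1 θ * cfc Real.log (ρ.1 θ)).trace.re

/-- The entropy functional `𝕊(ρ‖I) = ∫_S trace (ρ log ρ) dθ`. -/
def entropy (ρ : P.HermL2) : ℝ := ∫ θ in P.S, P.entropyDensity ρ θ

/-- The positive densities with moment `R`. -/
def conePosR (R : P.momentSpace) : Set P.HermL2 := {ρ ∈ P.conePos | P.L ρ = R}

/-- The right-hand side `(∇κ|_λ)⁻¹ (R - κ(λ))` of the differential equation. -/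
def odeField (R lam : P.momentSpace) : P.momentSpace :=
  (Ring.inverse (P.nablaKappa lam)) (R - P.kappa lam)

/-- `lam` solves `dλ/dt = (∇κ|_λ)⁻¹ (R - κ(λ))`, `λ(0) = lam0`, on the interval `[0, T)`. -/
def IsSolution (R lam0 : P.momentSpace) (T : EReal) (lam : ℝ → P.momentSpace) : Prop :=
  lam 0 = lam0 ∧ ∀ t : ℝ, 0 ≤ t → (t : EReal) < T →
    HasDerivWithinAt lam (P.odeField R (lam t)) (Ici 0) t

/-- `lam` is, on `[0, T)` with `0 < T ≤ ∞`, the maximal solution with initial value `lam0`: every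
solution with this initial value lives on a shorter or equal interval and agrees with `lam` there. -/
def IsMaximalSolution (R lam0 : P.momentSpace) (T : EReal) (lam : ℝ → P.momentSpace) : Prop :=
  0 < T ∧ P.IsSolution R lam0 T lam ∧
    ∀ (T' : EReal) (mu : ℝ → P.momentSpace), P.IsSolution R lam0 T' mu →
      T' ≤ T ∧ ∀ t : ℝ, 0 ≤ t → (t : EReal) < T' → mu t = lam t

end MomentData

end

/-! The flow is Newton's method in continuous time: along a solution `κ(λ_t)` satisfies a linear
equation, so it runs on the straight line `R + e^{-t}(κ(λ₀) - R)`. Everything follows once `κ` is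
known to be a diffeomorphism from `ℜ` onto `int 𝒦`.

Local part. The Duhamel formula (`exp_sub_exp_eq_duhamel`) gives `κ(x) - κ(y) = A(x, y)(x - y)` with
`A` continuous in both points and `A(x, x) = ∇κ|_x`. The pairing `⟨δ, A(x, y) δ⟩` is minus the
integral of a squared Frobenius norm, hence negative for `δ ≠ 0` (`kappaSlope_injective`). So `κ` is
injective, `∇κ` is invertible, and the inverse function theorem makes the range open.

Global part. Klein's inequality (`klein_inequality`) is weak duality between entropy and the
exponential family. It bounds `⟨λ, κ(λ) - L(ρ)⟩` above uniformly in `λ`, for each positive `ρ`. This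
coercivity makes the range relatively closed in the convex, hence connected, set `int 𝒦`; so
`range_kappa` identifies the two. The equality case of Klein's inequality yields the minimizer and
its uniqueness.

Flow. Solutions are exactly the lifts of the line through `κ⁻¹`. If `R ∈ int 𝒦`, the line stays
inside by convexity, and differentiability of `κ⁻¹` at `R` transfers the rate `e^{-t}`. If not, the
lift lives until the line leaves `int 𝒦` (possibly at infinity). A bounded subsequence of the lift
would place the limit point of the line in the range, which is impossible. -/

/-! ### The real Frobenius pairing -/

/-- The real pairing `Re trace (Aᴴ B)`. -/
noncomputable def frob {p q : ℕ} (A B : Matrix (Fin p) (Fin q) ℂ) : ℝ := (Aᴴ * B).trace.re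

theorem frob_add_left {p q : ℕ} (A B C : Matrix (Fin p) (Fin q) ℂ) :
    frob (A + B) C = frob A C + frob B C := by
  simp [frob, Matrix.add_mul]

theorem frob_add_right {p q : ℕ} (A B C : Matrix (Fin p) (Fin q) ℂ) :
    frob A (B + C) = frob A B + frob A C := by
  simp [frob, Matrix.mul_add]

theorem frob_smul_left {p q : ℕ} (c : ℝ) (A B : Matrix (Fin p) (Fin q) ℂ) :
    frob (c • A) B = c * frob A B := by
  simp [frob, Matrix.conjTranspose_smul]

theorem frob_smul_right {p q : ℕ} (c : ℝ) (A B : Matrix (Fin p) (Fin q) ℂ) :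
    frob A (c • B) = c * frob A B := by
  simp [frob]

theorem frob_neg_right {p q : ℕ} (A B : Matrix (Fin p) (Fin q) ℂ) :
    frob A (-B) = -frob A B := by
  simp [frob]

theorem frob_sub_right {p q : ℕ} (A B C : Matrix (Fin p) (Fin q) ℂ) :
    frob A (B - C) = frob A B - frob A C := by
  rw [sub_eq_add_neg, frob_add_right, frob_neg_right, sub_eq_add_neg]

theorem frob_zero_right {p q : ℕ} (A : Matrix (Fin p) (Fin q) ℂ) : frob A 0 = 0 := by
  simp [frob]

theorem frob_eq_sum {p q : ℕ} (A B : Matrix (Fin p) (Fin q) ℂ) :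
    frob A B = ∑ i, ∑ j, (star (A i j) * B i j).re := by
  rw [Finset.sum_comm]
  simp [frob, Matrix.trace, Matrix.mul_apply]

theorem frob_self_eq_sum {p q : ℕ} (A : Matrix (Fin p) (Fin q) ℂ) :
    frob A A = ∑ i, ∑ j, ‖A i j‖ ^ 2 := by
  rw [frob_eq_sum]
  refine Finset.sum_congr rfl fun i _ => Finset.sum_congr rfl fun j _ => ?_
  rw [← Complex.normSq_eq_norm_sq, ← Complex.ofReal_re (Complex.normSq _),
    Complex.normSq_eq_conj_mul_self]
  rfl

theorem frob_self_nonneg {p q : ℕ} (A : Matrix (Fin p) (Fin q) ℂ) : 0 ≤ frob A A := by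
  rw [frob_self_eq_sum]; positivity

theorem frob_self_eq_zero {p q : ℕ} {A : Matrix (Fin p) (Fin q) ℂ} (h : frob A A = 0) :
    A = 0 := by
  rw [frob_self_eq_sum, Finset.sum_eq_zero_iff_of_nonneg (fun i _ => by positivity)] at h
  ext i j
  have h1 := h i (Finset.mem_univ i)
  rw [Finset.sum_eq_zero_iff_of_nonneg (fun i _ => by positivity)] at h1
  simpa using h1 j (Finset.mem_univ j)

theorem frob_self_pos {p q : ℕ} {A : Matrix (Fin p) (Fin q) ℂ} (h : A ≠ 0) : 0 < frob A A :=
  (frob_self_nonneg A).lt_of_ne fun h0 => h (frob_self_eq_zero h0.symm)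

/-- Pairing a Hermitian matrix only sees the Hermitian part. -/
theorem re_trace_hermPart_mul {m : ℕ} (N : Matrix (Fin m) (Fin m) ℂ)
    {B : Matrix (Fin m) (Fin m) ℂ} (hB : B.IsHermitian) :
    (hermPart N * B).trace.re = (N * B).trace.re := by
  have h : (Nᴴ * B).trace.re = (N * B).trace.re := by
    rw [← hB.eq, ← Matrix.conjTranspose_mul, Matrix.trace_conjTranspose, hB.eq,
      Matrix.trace_mul_comm]
    simp
  simp only [hermPart, Matrix.smul_mul, Matrix.add_mul, Matrix.trace_smul, Matrix.trace_add,
    Complex.add_re, Complex.real_smul, Complex.mul_re, Complex.ofReal_re, Complex.ofReal_im, h]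
  ring

theorem hermPart_of_isHermitian {m : ℕ} {B : Matrix (Fin m) (Fin m) ℂ} (hB : B.IsHermitian) :
    hermPart B = B := by
  rw [hermPart, hB.eq, ← two_smul ℝ B, smul_smul]; norm_num

theorem hermPart_add {m : ℕ} (A B : Matrix (Fin m) (Fin m) ℂ) :
    hermPart (A + B) = hermPart A + hermPart B := by
  simp only [hermPart, Matrix.conjTranspose_add, ← smul_add]
  congr 1; abel

theorem hermPart_smul {m : ℕ} (c : ℝ) (A : Matrix (Fin m) (Fin m) ℂ) :
    hermPart (c • A) = c • hermPart A := by
  simp only [hermPart, Matrix.conjTranspose_smul, star_trivial, ← smul_add]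
  rw [smul_comm]

theorem continuous_hermPart {m : ℕ} :
    Continuous (hermPart : Matrix (Fin m) (Fin m) ℂ → Matrix (Fin m) (Fin m) ℂ) :=
  (continuous_id.add continuous_id.matrix_conjTranspose).const_smul (1 / 2 : ℝ)

/-! ### The Duhamel formula for the matrix exponential -/

/-- The integral `∫₀¹ exp ((1 - τ) X) D exp (τ Y) dτ`, entry by entry. -/
noncomputable def duhamel {m : ℕ} (X Y D : Matrix (Fin m) (Fin m) ℂ) :
    Matrix (Fin m) (Fin m) ℂ :=
  Matrix.of fun i j => ∫ τ in (0 : ℝ)..1,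
    (NormedSpace.exp ((1 - τ) • X) * D * NormedSpace.exp (τ • Y)) i j

theorem continuous_duhamel_integrand {m : ℕ} {Z : Type*} [TopologicalSpace Z]
    {X Y D : Z → Matrix (Fin m) (Fin m) ℂ} (hX : Continuous X) (hY : Continuous Y)
    (hD : Continuous D) :
    Continuous fun z : Z × ℝ =>
      NormedSpace.exp ((1 - z.2) • X z.1) * D z.1 * NormedSpace.exp (z.2 • Y z.1) := by
  have h1 : Continuous fun z : Z × ℝ => NormedSpace.exp ((1 - z.2) • X z.1) :=
    continuous_matrix_exp.comp (by fun_prop)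
  have h2 : Continuous fun z : Z × ℝ => NormedSpace.exp (z.2 • Y z.1) :=
    continuous_matrix_exp.comp (by fun_prop)
  exact (h1.matrix_mul (hD.comp continuous_fst)).matrix_mul h2

theorem continuous_duhamel_integrand_const {m : ℕ} (X Y D : Matrix (Fin m) (Fin m) ℂ) :
    Continuous fun τ : ℝ => NormedSpace.exp ((1 - τ) • X) * D * NormedSpace.exp (τ • Y) :=
  (continuous_duhamel_integrand (Z := Unit) (X := fun _ => X) (Y := fun _ => Y) (D := fun _ => D)
    continuous_const continuous_const continuous_const).comp
      (g := fun z => _) (f := fun τ : ℝ => ((), τ)) (by fun_prop)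

theorem continuous_duhamel {m : ℕ} {Z : Type*} [TopologicalSpace Z]
    {X Y D : Z → Matrix (Fin m) (Fin m) ℂ} (hX : Continuous X) (hY : Continuous Y)
    (hD : Continuous D) : Continuous fun z => duhamel (X z) (Y z) (D z) := by
  refine continuous_matrix fun i j => ?_
  exact intervalIntegral.continuous_parametric_intervalIntegral_of_continuous'
    (f := fun (z : Z) (τ : ℝ) => (NormedSpace.exp ((1 - τ) • X z) * D z *
      NormedSpace.exp (τ • Y z)) i j)
    ((continuous_duhamel_integrand hX hY hD).matrix_elem i j) 0 1

theorem duhamel_add {m : ℕ} (X Y D E : Matrix (Fin m) (Fin m) ℂ) :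
    duhamel X Y (D + E) = duhamel X Y D + duhamel X Y E := by
  ext i j
  simp only [duhamel, Matrix.of_apply, Matrix.add_apply]
  rw [← intervalIntegral.integral_add
    (((continuous_duhamel_integrand_const X Y D).matrix_elem i j).intervalIntegrable _ _)
    (((continuous_duhamel_integrand_const X Y E).matrix_elem i j).intervalIntegrable _ _)]
  simp only [Matrix.mul_add, Matrix.add_mul, Matrix.add_apply]

theorem duhamel_smul {m : ℕ} (c : ℝ) (X Y D : Matrix (Fin m) (Fin m) ℂ) :
    duhamel X Y (c • D) = c • duhamel X Y D := by
  ext i j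
  simp only [duhamel, Matrix.of_apply, Matrix.smul_apply]
  rw [← intervalIntegral.integral_smul]
  simp only [Matrix.mul_smul, Matrix.smul_mul, Matrix.smul_apply]

theorem scrambledMul_exp_eq_duhamel {m : ℕ} {A : Matrix (Fin m) (Fin m) ℂ} (hA : A.IsHermitian)
    (D : Matrix (Fin m) (Fin m) ℂ) :
    scrambledMul (NormedSpace.exp A) D = duhamel A A D := scrambledMul_exp hA D

theorem hasDerivAt_matrix_exp_smul {m : ℕ} (X : Matrix (Fin m) (Fin m) ℂ) (t : ℝ) :
    HasDerivAt (fun u : ℝ => NormedSpace.exp (u • X)) (NormedSpace.exp (t • X) * X) t := by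
  let _ : NormedRing (Matrix (Fin m) (Fin m) ℂ) := Matrix.frobeniusNormedRing
  let _ : NormedAlgebra ℝ (Matrix (Fin m) (Fin m) ℂ) := Matrix.frobeniusNormedAlgebra
  exact hasDerivAt_exp_smul_const X t

theorem commute_exp_smul_self {m : ℕ} (X : Matrix (Fin m) (Fin m) ℂ) (t : ℝ) :
    NormedSpace.exp (t • X) * X = X * NormedSpace.exp (t • X) := by
  let _ : NormedRing (Matrix (Fin m) (Fin m) ℂ) := Matrix.frobeniusNormedRing
  let _ : NormedAlgebra ℝ (Matrix (Fin m) (Fin m) ℂ) := Matrix.frobeniusNormedAlgebra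
  let _ : NormedAlgebra ℚ (Matrix (Fin m) (Fin m) ℂ) := NormedAlgebra.restrictScalars ℚ ℝ _
  exact (((Commute.refl X).smul_left t).exp_left).eq

/-- Integrate the derivative of `τ ↦ exp((1 - τ)X) exp(τY)` over `[0, 1]`. Keeping two different
exponents makes this an exact difference formula, which serves both for injectivity of `κ` and for
its derivative. -/
theorem exp_sub_exp_eq_duhamel {m : ℕ} (X Y : Matrix (Fin m) (Fin m) ℂ) :
    NormedSpace.exp X - NormedSpace.exp Y = duhamel X Y (X - Y) := by
  have hd : ∀ τ : ℝ, HasDerivAt (fun τ : ℝ =>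
      NormedSpace.exp ((1 - τ) • X) * NormedSpace.exp (τ • Y))
      (-(NormedSpace.exp ((1 - τ) • X) * (X - Y) * NormedSpace.exp (τ • Y))) τ := by
    intro τ
    let _ : NormedRing (Matrix (Fin m) (Fin m) ℂ) := Matrix.frobeniusNormedRing
    let _ : NormedAlgebra ℝ (Matrix (Fin m) (Fin m) ℂ) := Matrix.frobeniusNormedAlgebra
    have h1 := (hasDerivAt_matrix_exp_smul X (1 - τ)).scomp τ ((hasDerivAt_id τ).const_sub 1)
    have h2 := hasDerivAt_matrix_exp_smul Y τ
    refine (h1.mul h2).congr_deriv ?_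
    rw [commute_exp_smul_self Y]
    simp only [Function.comp_apply, mul_sub, sub_mul, neg_smul, one_smul, neg_mul, mul_assoc]
    abel
  ext i j
  have he : ∀ τ : ℝ, HasDerivAt (fun τ : ℝ =>
      (NormedSpace.exp ((1 - τ) • X) * NormedSpace.exp (τ • Y)) i j)
      (-((NormedSpace.exp ((1 - τ) • X) * (X - Y) * NormedSpace.exp (τ • Y)) i j)) τ := fun τ =>
    hasDerivAt_pi.1 (hasDerivAt_pi.1 (hd τ) i) j
  have hi := intervalIntegral.integral_eq_sub_of_hasDerivAt (a := 0) (b := 1) (fun τ _ => he τ)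
    ((((continuous_duhamel_integrand_const X Y (X - Y)).matrix_elem i j).neg).intervalIntegrable
      _ _)
  rw [intervalIntegral.integral_neg] at hi
  simp only [sub_self, zero_smul, NormedSpace.exp_zero, one_smul, sub_zero, one_mul, mul_one] at hi
  simp only [duhamel, Matrix.of_apply, Matrix.sub_apply] at hi ⊢
  linear_combination hi

/-! ### Exponentials of Hermitian matrices -/

theorem smul_isHermitian {m : ℕ} (c : ℝ) {X : Matrix (Fin m) (Fin m) ℂ} (hX : X.IsHermitian) :
    (c • X).IsHermitian := by
  rw [Matrix.IsHermitian, Matrix.conjTranspose_smul, hX.eq, star_trivial]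

theorem exp_smul_eq_half_mul_half {m : ℕ} (c : ℝ) (X : Matrix (Fin m) (Fin m) ℂ) :
    NormedSpace.exp (c • X) =
      NormedSpace.exp ((c / 2) • X) * NormedSpace.exp ((c / 2) • X) := by
  rw [← Matrix.exp_add_of_commute _ _ (Commute.refl _), ← add_smul, add_halves]

theorem posDef_exp {m : ℕ} {X : Matrix (Fin m) (Fin m) ℂ} (hX : X.IsHermitian) :
    (NormedSpace.exp X).PosDef := by
  have hh : (NormedSpace.exp ((1 / 2 : ℝ) • X)).IsHermitian := (smul_isHermitian _ hX).exp
  have h : NormedSpace.exp X =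
      (NormedSpace.exp ((1 / 2 : ℝ) • X))ᴴ * NormedSpace.exp ((1 / 2 : ℝ) • X) := by
    rw [hh.eq, ← exp_smul_eq_half_mul_half, one_smul]
  rw [h]
  exact Matrix.PosDef.conjTranspose_mul_self _
    (Matrix.mulVec_injective_of_isUnit (Matrix.isUnit_exp _))

/-- Halve each exponential and cycle the trace: the quadratic form of the Duhamel integrand is a
squared norm. -/
theorem re_trace_mul_exp_mul_exp {m : ℕ} {X Y D : Matrix (Fin m) (Fin m) ℂ}
    (hX : X.IsHermitian) (hY : Y.IsHermitian) (hD : D.IsHermitian) (a b : ℝ) :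
    (D * (NormedSpace.exp (a • X) * D * NormedSpace.exp (b • Y))).trace.re =
      frob (NormedSpace.exp ((a / 2) • X) * D * NormedSpace.exp ((b / 2) • Y))
        (NormedSpace.exp ((a / 2) • X) * D * NormedSpace.exp ((b / 2) • Y)) := by
  have hE : (NormedSpace.exp ((a / 2) • X)).IsHermitian := (smul_isHermitian _ hX).exp
  have hF : (NormedSpace.exp ((b / 2) • Y)).IsHermitian := (smul_isHermitian _ hY).exp
  rw [frob, exp_smul_eq_half_mul_half a, exp_smul_eq_half_mul_half b]
  simp only [Matrix.conjTranspose_mul, hE.eq, hF.eq, hD.eq, Matrix.mul_assoc]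
  rw [Matrix.trace_mul_comm (NormedSpace.exp ((b / 2) • Y))]
  simp only [Matrix.mul_assoc]

theorem re_trace_mul_integral {m : ℕ} (D : Matrix (Fin m) (Fin m) ℂ)
    {M : ℝ → Matrix (Fin m) (Fin m) ℂ} (hM : Continuous M) :
    (D * Matrix.of fun i j => ∫ τ in (0 : ℝ)..1, M τ i j).trace.re =
      ∫ τ in (0 : ℝ)..1, (D * M τ).trace.re := by
  have h1 : (D * Matrix.of fun i j => ∫ τ in (0 : ℝ)..1, M τ i j).trace =
      ∫ τ in (0 : ℝ)..1, (D * M τ).trace := by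
    simp only [Matrix.trace, Matrix.diag_apply, Matrix.mul_apply, Matrix.of_apply]
    have hc : ∀ i j, Continuous fun τ => D i j * M τ j i := fun i j =>
      continuous_const.mul (hM.matrix_elem j i)
    rw [intervalIntegral.integral_finsetSum fun i _ => Continuous.intervalIntegrable
      (continuous_finsetSum _ fun j _ => hc i j) _ _]
    refine Finset.sum_congr rfl fun i _ => ?_
    rw [intervalIntegral.integral_finsetSum fun j _ => Continuous.intervalIntegrable
      (hc i j) _ _]
    refine Finset.sum_congr rfl fun j _ => ?_
    rw [intervalIntegral.integral_const_mul]
  have hi : IntervalIntegrable (fun τ : ℝ => (D * M τ).trace) volume 0 1 :=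
    ((continuous_const.matrix_mul hM).matrix_trace).intervalIntegrable _ _
  rw [h1]
  exact (Complex.reCLM.intervalIntegral_comp_comm hi).symm

theorem re_trace_mul_duhamel {m : ℕ} (X Y D : Matrix (Fin m) (Fin m) ℂ) :
    (D * duhamel X Y D).trace.re = ∫ τ in (0 : ℝ)..1,
      (D * (NormedSpace.exp ((1 - τ) • X) * D * NormedSpace.exp (τ • Y))).trace.re :=
  re_trace_mul_integral D (continuous_duhamel_integrand_const X Y D)

theorem re_trace_mul_duhamel_nonneg {m : ℕ} {X Y D : Matrix (Fin m) (Fin m) ℂ}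
    (hX : X.IsHermitian) (hY : Y.IsHermitian) (hD : D.IsHermitian) :
    0 ≤ (D * duhamel X Y D).trace.re := by
  rw [re_trace_mul_duhamel]
  refine intervalIntegral.integral_nonneg zero_le_one fun τ _ => ?_
  rw [re_trace_mul_exp_mul_exp hX hY hD]
  exact frob_self_nonneg _

theorem eq_zero_of_re_trace_mul_duhamel {m : ℕ} {X Y D : Matrix (Fin m) (Fin m) ℂ}
    (hX : X.IsHermitian) (hY : Y.IsHermitian) (hD : D.IsHermitian)
    (h : (D * duhamel X Y D).trace.re = 0) : D = 0 := by
  by_contra hne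
  refine h.not_gt ?_
  rw [re_trace_mul_duhamel]
  refine intervalIntegral.intervalIntegral_pos_of_pos_on
    ((Complex.continuous_re.comp (continuous_const.matrix_mul
      (continuous_duhamel_integrand_const X Y D)).matrix_trace).intervalIntegrable _ _)
    (fun τ _ => ?_) zero_lt_one
  rw [re_trace_mul_exp_mul_exp hX hY hD]
  refine frob_self_pos fun h0 => hne ?_
  -- Exponentials are invertible, so they cancel on both sides and leave `D = 0`.
  rw [(Matrix.isUnit_exp _).mul_left_eq_zero] at h0
  exact (Matrix.isUnit_exp _).mul_right_eq_zero.1 h0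

/-! ### Klein's inequality -/

theorem continuousOn_real_spectrum {m : ℕ} (f : ℝ → ℝ) (A : Matrix (Fin m) (Fin m) ℂ) :
    ContinuousOn f (spectrum ℝ A) :=
  Set.Finite.continuousOn Matrix.finite_real_spectrum _

/-- Traces of products `f(A) g(B)` are given by nonnegative weights on pairs of eigenvalues. -/
theorem exists_spectral_weights {m : ℕ} {A B : Matrix (Fin m) (Fin m) ℂ} (hA : A.IsHermitian)
    (hB : B.IsHermitian) : ∃ w : Fin m → Fin m → ℝ, (∀ i j, 0 ≤ w i j) ∧ ∀ f g : ℝ → ℝ,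
      (cfc f A * cfc g B).trace.re =
        ∑ i, ∑ j, w i j * (f (hA.eigenvalues i) * g (hB.eigenvalues j)) := by
  refine ⟨fun i j => Complex.normSq
    ((star (hA.eigenvectorUnitary : Matrix (Fin m) (Fin m) ℂ) * hB.eigenvectorUnitary) i j),
    fun i j => Complex.normSq_nonneg _, fun f g => ?_⟩
  rw [hA.cfc_eq, hB.cfc_eq, Matrix.IsHermitian.cfc, Matrix.IsHermitian.cfc,
    Unitary.conjStarAlgAut_apply, Unitary.conjStarAlgAut_apply]
  set U : Matrix (Fin m) (Fin m) ℂ := (hA.eigenvectorUnitary : Matrix (Fin m) (Fin m) ℂ)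
  set V : Matrix (Fin m) (Fin m) ℂ := (hB.eigenvectorUnitary : Matrix (Fin m) (Fin m) ℂ)
  set W := star U * V with hW
  have hW' : star V * U = Wᴴ := by
    rw [hW, Matrix.conjTranspose_mul]; simp [Matrix.star_eq_conjTranspose]
  have h : ∀ F G : Matrix (Fin m) (Fin m) ℂ,
      (U * F * star U * (V * G * star V)).trace = (F * (W * G * Wᴴ)).trace := fun F G => by
    rw [← hW', hW]
    simp only [Matrix.mul_assoc]
    rw [Matrix.trace_mul_comm U]
    simp only [Matrix.mul_assoc]
  rw [h]
  simp only [Matrix.trace, Matrix.diag_apply, Matrix.diagonal_mul, Function.comp_apply]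
  rw [Complex.re_sum]
  refine Finset.sum_congr rfl fun i _ => ?_
  rw [Matrix.mul_apply, Finset.mul_sum, Complex.re_sum]
  refine Finset.sum_congr rfl fun j _ => ?_
  rw [Matrix.mul_diagonal, Matrix.conjTranspose_apply]
  simp only [Function.comp_apply, Complex.coe_algebraMap, RCLike.star_def,
    Complex.normSq_apply, Complex.mul_re, Complex.mul_im, Complex.conj_re, Complex.conj_im,
    Complex.ofReal_re, Complex.ofReal_im]
  ring

theorem mul_cfc_log_eq {m : ℕ} {ρ : Matrix (Fin m) (Fin m) ℂ} (hρ : ρ.IsHermitian) :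
    ρ * cfc Real.log ρ = cfc (fun x : ℝ => x * Real.log x) ρ := by
  have hsa : IsSelfAdjoint ρ := hρ
  rw [cfc_mul (fun x : ℝ => x) Real.log ρ (continuousOn_real_spectrum _ _)
    (continuousOn_real_spectrum _ _), cfc_id' ℝ ρ]

theorem cfc_exp_neg_eq {m : ℕ} {A : Matrix (Fin m) (Fin m) ℂ} (hA : A.IsHermitian) :
    cfc (fun x : ℝ => (Real.exp 1)⁻¹ * Real.exp (-x)) A =
      (Real.exp 1)⁻¹ • NormedSpace.exp (-A) := by
  have hsa : IsSelfAdjoint A := hA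
  rw [cfc_const_mul _ (fun x : ℝ => Real.exp (-x)) A (continuousOn_real_spectrum _ _),
    ← cfc_exp_eq hA.neg, cfc_comp_neg Real.exp A (Real.continuous_exp.continuousOn)]

/-- Fenchel–Young for `r log r`: writing `e^{-1-a} = r e^x` with `x = -1 - a - log r`, this is `x +
1 ≤ e^x`. Equality forces `x = 0`. -/
theorem entropy_scalar_nonneg {r : ℝ} (hr : 0 < r) (a : ℝ) :
    0 ≤ r * Real.log r + a * r + (Real.exp 1)⁻¹ * Real.exp (-a) := by
  have h1 := Real.add_one_le_exp (-1 - a - Real.log r)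
  have h2 : (Real.exp 1)⁻¹ * Real.exp (-a) = r * Real.exp (-1 - a - Real.log r) := by
    rw [Real.exp_sub _ (Real.log r), Real.exp_log hr, ← Real.exp_neg, ← Real.exp_add]
    field_simp
    ring_nf
  rw [h2]
  nlinarith

theorem eq_of_entropy_scalar_eq_zero {r : ℝ} (hr : 0 < r) {a : ℝ}
    (h : r * Real.log r + a * r + (Real.exp 1)⁻¹ * Real.exp (-a) = 0) :
    r = (Real.exp 1)⁻¹ * Real.exp (-a) := by
  have h2 : (Real.exp 1)⁻¹ * Real.exp (-a) = r * Real.exp (-1 - a - Real.log r) := by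
    rw [Real.exp_sub _ (Real.log r), Real.exp_log hr, ← Real.exp_neg, ← Real.exp_add]
    field_simp
    ring_nf
  by_cases h0 : -1 - a - Real.log r = 0
  · rw [h2, h0, Real.exp_zero, mul_one]
  · have h1 := Real.add_one_lt_exp h0
    rw [h2] at h
    nlinarith

/-- **Klein's inequality** in the form of weak duality between a density `ρ` and the exponential
density with exponent `-A`. -/
theorem klein_inequality {m : ℕ} {ρ A : Matrix (Fin m) (Fin m) ℂ} (hρ : ρ.PosDef)
    (hA : A.IsHermitian) :
    0 ≤ (ρ * cfc Real.log ρ).trace.re + (A * ρ).trace.re +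
        ((Real.exp 1)⁻¹ • NormedSpace.exp (-A)).trace.re ∧
      ((ρ * cfc Real.log ρ).trace.re + (A * ρ).trace.re +
        ((Real.exp 1)⁻¹ • NormedSpace.exp (-A)).trace.re = 0 →
          ρ = (Real.exp 1)⁻¹ • NormedSpace.exp (-A)) := by
  have hsa : IsSelfAdjoint A := hA
  have hsr : IsSelfAdjoint ρ := hρ.isHermitian
  obtain ⟨w, hw, hs⟩ := exists_spectral_weights hρ.isHermitian hA
  set s : ℝ → ℝ := fun x => (Real.exp 1)⁻¹ * Real.exp (-x) with hsdef
  set r := hρ.isHermitian.eigenvalues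
  set a := hA.eigenvalues
  have hr : ∀ i, 0 < r i := hρ.eigenvalues_pos
  have e1 : (ρ * cfc Real.log ρ).trace.re = ∑ i, ∑ j, w i j * (r i * Real.log (r i) * 1) := by
    rw [← hs (fun x => x * Real.log x) (fun _ => 1), cfc_const_one ℝ A, mul_one,
      mul_cfc_log_eq hρ.isHermitian]
  have e2 : (A * ρ).trace.re = ∑ i, ∑ j, w i j * (r i * a j) := by
    rw [← hs (fun x => x) (fun x => x), cfc_id' ℝ A, cfc_id' ℝ ρ, Matrix.trace_mul_comm]
  have e3 : ((Real.exp 1)⁻¹ • NormedSpace.exp (-A)).trace.re =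
      ∑ i, ∑ j, w i j * (1 * s (a j)) := by
    rw [← hs (fun _ => 1) s, cfc_const_one ℝ ρ, one_mul, cfc_exp_neg_eq hA]
  have e : (ρ * cfc Real.log ρ).trace.re + (A * ρ).trace.re +
      ((Real.exp 1)⁻¹ • NormedSpace.exp (-A)).trace.re =
        ∑ i, ∑ j, w i j * (r i * Real.log (r i) + a j * r i + s (a j)) := by
    rw [e1, e2, e3, ← Finset.sum_add_distrib, ← Finset.sum_add_distrib]
    refine Finset.sum_congr rfl fun i _ => ?_
    rw [← Finset.sum_add_distrib, ← Finset.sum_add_distrib]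
    refine Finset.sum_congr rfl fun j _ => ?_
    ring
  have hnn : ∀ i j, 0 ≤ w i j * (r i * Real.log (r i) + a j * r i + s (a j)) := fun i j =>
    mul_nonneg (hw i j) (entropy_scalar_nonneg (hr i) (a j))
  rw [e]
  refine ⟨Finset.sum_nonneg fun i _ => Finset.sum_nonneg fun j _ => hnn i j, fun h0 => ?_⟩
  -- A vanishing sum of nonnegative terms: wherever the weight is nonzero, the scalar equality case
  -- identifies the two eigenvalues.
  have hz : ∀ i j, w i j * (r i - s (a j)) = 0 := fun i j => by
    rw [Finset.sum_eq_zero_iff_of_nonneg fun i _ => Finset.sum_nonneg fun j _ => hnn i j] at h0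
    have h1 := h0 i (Finset.mem_univ i)
    rw [Finset.sum_eq_zero_iff_of_nonneg fun j _ => hnn i j] at h1
    rcases mul_eq_zero.1 (h1 j (Finset.mem_univ j)) with h2 | h2
    · rw [h2, zero_mul]
    · rw [sub_eq_zero.2 (eq_of_entropy_scalar_eq_zero (hr i) h2), mul_zero]
  rw [← cfc_exp_neg_eq hA]
  set σ := cfc s A with hσ
  have hσh : σ.IsHermitian := cfc_predicate s A
  have f1 : (ρ * ρ).trace.re = ∑ i, ∑ j, w i j * (r i * r i * 1) := by
    rw [← hs (fun x => x * x) (fun _ => 1), cfc_const_one ℝ A, mul_one,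
      cfc_mul (fun x : ℝ => x) (fun x => x) ρ (continuousOn_real_spectrum _ _)
        (continuousOn_real_spectrum _ _), cfc_id' ℝ ρ]
  have f2 : (ρ * σ).trace.re = ∑ i, ∑ j, w i j * (r i * s (a j)) := by
    rw [← hs (fun x => x) s, cfc_id' ℝ ρ]
  have f3 : (σ * σ).trace.re = ∑ i, ∑ j, w i j * (1 * (s (a j) * s (a j))) := by
    rw [← hs (fun _ => 1) (fun x => s x * s x), cfc_const_one ℝ ρ, one_mul,
      cfc_mul s s A (continuousOn_real_spectrum _ _) (continuousOn_real_spectrum _ _)]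
  -- With the same weights, `‖ρ - σ‖²` equals the sum of `w i j * (r i - s (a j))²`, so `hz` makes
  -- it vanish.
  refine sub_eq_zero.1 (frob_self_eq_zero ?_)
  have f : frob (ρ - σ) (ρ - σ) = (ρ * ρ).trace.re - 2 * (ρ * σ).trace.re + (σ * σ).trace.re := by
    rw [frob, (hρ.isHermitian.sub hσh).eq]
    simp only [Matrix.sub_mul, Matrix.mul_sub, Matrix.trace_sub, Complex.sub_re,
      Matrix.trace_mul_comm σ ρ]
    ring
  rw [f, f1, f2, f3, Finset.mul_sum, ← Finset.sum_sub_distrib, ← Finset.sum_add_distrib]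
  refine Finset.sum_eq_zero fun i _ => ?_
  rw [Finset.mul_sum, ← Finset.sum_sub_distrib, ← Finset.sum_add_distrib]
  refine Finset.sum_eq_zero fun j _ => ?_
  linear_combination (r i - s (a j)) * hz i j

/-- The exponential density attains equality in Klein's inequality. -/
theorem klein_equality {m : ℕ} {A : Matrix (Fin m) (Fin m) ℂ} (hA : A.IsHermitian) :
    (((Real.exp 1)⁻¹ • NormedSpace.exp (-A)) *
        cfc Real.log ((Real.exp 1)⁻¹ • NormedSpace.exp (-A))).trace.re +
      (A * ((Real.exp 1)⁻¹ • NormedSpace.exp (-A))).trace.re +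
        ((Real.exp 1)⁻¹ • NormedSpace.exp (-A)).trace.re = 0 := by
  have hsa : IsSelfAdjoint A := hA
  set s : ℝ → ℝ := fun x => (Real.exp 1)⁻¹ * Real.exp (-x) with hsdef
  rw [← cfc_exp_neg_eq hA, ← hsdef]
  have hl : cfc Real.log (cfc s A) = cfc (fun x => Real.log (s x)) A :=
    (cfc_comp' Real.log s A (Set.Finite.continuousOn
      (Set.Finite.image _ Matrix.finite_real_spectrum) _) (continuousOn_real_spectrum _ _)).symm
  rw [hl, ← cfc_mul s (fun x => Real.log (s x)) A (continuousOn_real_spectrum _ _)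
    (continuousOn_real_spectrum _ _)]
  conv_lhs => enter [1, 2, 1, 1, 1]; rw [← cfc_id' ℝ A]
  rw [← cfc_mul (fun x : ℝ => x) s A (continuousOn_real_spectrum _ _)
    (continuousOn_real_spectrum _ _), ← Complex.add_re, ← Complex.add_re, ← Matrix.trace_add,
    ← Matrix.trace_add,
    ← cfc_add A (fun x => s x * Real.log (s x)) (fun x => x * s x)
      (continuousOn_real_spectrum _ _) (continuousOn_real_spectrum _ _),
    ← cfc_add A (fun x => s x * Real.log (s x) + x * s x) s
      (continuousOn_real_spectrum _ _) (continuousOn_real_spectrum _ _)]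
  have h0 : (fun x => s x * Real.log (s x) + x * s x + s x) = fun _ : ℝ => (0 : ℝ) := by
    funext x
    have hx : Real.log (s x) = -1 - x := by
      simp only [hsdef]
      rw [← Real.exp_neg, ← Real.exp_add, Real.log_exp]; ring
    rw [hx]; ring
  rw [h0, cfc_const_zero]
  simp

/-! ### Finite-dimensional calculus -/

theorem firstCountableTopology_of_normed (E : Type*) [NormedAddCommGroup E] :
    FirstCountableTopology E := inferInstance

theorem locallyCompactSpace_of_finiteDimensional (E : Type*) [NormedAddCommGroup E]
    [NormedSpace ℝ E] [FiniteDimensional ℝ E] : LocallyCompactSpace E :=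
  have := FiniteDimensional.proper_real E
  inferInstance

/-- A map whose difference quotients are given by a continuous family of linear maps is strictly
differentiable. -/
theorem hasStrictFDerivAt_of_slope {E : Type*} [NormedAddCommGroup E] [NormedSpace ℝ E]
    [FiniteDimensional ℝ E] {f : E → E} {s : E → E → Module.End ℝ E}
    (hs : ∀ δ, Continuous fun z : E × E => s z.1 z.2 δ)
    (hf : ∀ x y, f x - f y = s x y (x - y)) (x : E) :
    HasStrictFDerivAt f (LinearMap.toContinuousLinearMap (s x x)) x := by
  have hc : Continuous fun z : E × E => LinearMap.toContinuousLinearMap (s z.1 z.2) :=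
    continuous_clm_apply.2 hs
  refine .of_isLittleO (Asymptotics.isLittleO_iff.2 fun c hc0 => ?_)
  have h := (hc.tendsto (x, x)).eventually (Metric.ball_mem_nhds _ hc0)
  filter_upwards [h] with z hz
  rw [hf]
  rw [dist_eq_norm] at hz
  exact (ContinuousLinearMap.le_opNorm (LinearMap.toContinuousLinearMap (s z.1 z.2) -
      LinearMap.toContinuousLinearMap (s x x)) (z.1 - z.2)).trans
    (mul_le_mul_of_nonneg_right hz.le (norm_nonneg _))

namespace MomentData

variable {k m p q : ℕ} (P : MomentData k m p q)

/-! ### Entropy is finite -/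

theorem ae_restrict_S {Q : EuclideanSpace ℝ (Fin k) → Prop} (h : ∀ θ ∈ P.S, Q θ) :
    ∀ᵐ θ ∂(volume.restrict P.S), Q θ :=
  (ae_restrict_iff' P.isCompact_S.measurableSet).2 (Eventually.of_forall h)

theorem aestronglyMeasurable_aeval (ρ : P.HermL2) (f : Polynomial ℝ) (i j : Fin m) :
    AEStronglyMeasurable (fun θ => (Polynomial.aeval (ρ.1 θ) f) i j) (volume.restrict P.S) := by
  have hpow : ∀ (n : ℕ) (i j : Fin m),
      AEStronglyMeasurable (fun θ => (ρ.1 θ ^ n) i j) (volume.restrict P.S) := by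
    intro n
    induction n with
    | zero => intro i j; simpa using aestronglyMeasurable_const
    | succ n ih =>
      intro i j
      simp only [pow_succ, Matrix.mul_apply]
      exact Finset.aestronglyMeasurable_fun_sum _ fun l _ =>
        (ih i l).mul (ρ.2.1 l j).aestronglyMeasurable
  simp only [Polynomial.aeval_eq_sum_range, Matrix.sum_apply, Matrix.smul_apply]
  exact Finset.aestronglyMeasurable_fun_sum _ fun n _ => (hpow n i j).const_smul (f.coeff n)

theorem re_trace_cfc_eq_sum {A : Matrix (Fin m) (Fin m) ℂ} (hA : A.IsHermitian) :
    ∃ w : Fin m → ℝ, (∀ i, 0 ≤ w i) ∧ ∀ f : ℝ → ℝ,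
      (cfc f A).trace.re = ∑ i, w i * f (hA.eigenvalues i) := by
  have hsa : IsSelfAdjoint A := hA
  obtain ⟨w, hw, h⟩ := exists_spectral_weights hA hA
  refine ⟨fun i => ∑ j, w i j, fun i => Finset.sum_nonneg fun j _ => hw i j, fun f => ?_⟩
  have := h f fun _ => 1
  rw [cfc_const_one ℝ A, mul_one] at this
  rw [this]
  refine Finset.sum_congr rfl fun i _ => ?_
  rw [Finset.sum_mul]
  simp

/-- Weierstrass approximation on the growing intervals `[-n, n]`: polynomials in `ρ` have measurable
entries, and each finite spectrum eventually lies in the interval, so the traces converge pointwise.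
-/
theorem aestronglyMeasurable_re_trace_cfc (ρ : P.HermL2) {f : ℝ → ℝ} (hf : Continuous f) :
    AEStronglyMeasurable (fun θ => (cfc f (ρ.1 θ)).trace.re) (volume.restrict P.S) := by
  have hp : ∀ n : ℕ, ∃ p : Polynomial ℝ, ∀ x ∈ Icc (-(n : ℝ)) n,
      |p.eval x - f x| < 1 / ((n : ℝ) + 1) := fun n =>
    exists_polynomial_near_of_continuousOn _ _ f hf.continuousOn _ (by positivity)
  choose g hg using hp
  have hlim : ∀ x, Tendsto (fun n => (g n).eval x) atTop (𝓝 (f x)) := by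
    intro x
    rw [tendsto_iff_dist_tendsto_zero]
    obtain ⟨N, hN⟩ := exists_nat_ge |x|
    refine squeeze_zero' (Eventually.of_forall fun _ => dist_nonneg) ?_
      tendsto_one_div_add_atTop_nhds_zero_nat
    filter_upwards [eventually_ge_atTop N] with n hn
    have hx : |x| ≤ n := hN.trans (by exact_mod_cast hn)
    rw [Real.dist_eq]
    exact (hg n x (abs_le.1 hx)).le
  refine aestronglyMeasurable_of_tendsto_ae atTop
    (f := fun n θ => (Polynomial.aeval (ρ.1 θ) (g n)).trace.re) (fun n => ?_)
    (P.ae_restrict_S fun θ hθ => ?_)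
  · refine Complex.continuous_re.comp_aestronglyMeasurable ?_
    simp only [Matrix.trace, Matrix.diag_apply]
    exact Finset.aestronglyMeasurable_fun_sum _ fun i _ => P.aestronglyMeasurable_aeval ρ _ i i
  · have hh := ρ.2.2 θ hθ
    have hsa : IsSelfAdjoint (ρ.1 θ) := hh
    obtain ⟨w, -, hw⟩ := re_trace_cfc_eq_sum hh
    simp only [← cfc_polynomial _ (ρ.1 θ), hw]
    exact tendsto_finsetSum _ fun i _ => (hlim _).const_mul _

theorem abs_mul_log_le {x : ℝ} (hx : 0 < x) : |x * Real.log x| ≤ 1 + x ^ 2 := by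
  have h1 := Real.log_le_sub_one_of_pos hx
  have h2 := Real.one_sub_inv_le_log_of_pos hx
  have h3 : x * (1 - x⁻¹) = x - 1 := by field_simp
  rw [abs_le]
  constructor <;> nlinarith [mul_le_mul_of_nonneg_left h1 hx.le, mul_le_mul_of_nonneg_left h2 hx.le]

/-- Sum the scalar bound `|x log x| ≤ 1 + x²` over eigenvalues. The right-hand side is integrable
because `ρ` is square integrable and `S` has finite measure. -/
theorem abs_re_trace_mul_log_le {ρ : Matrix (Fin m) (Fin m) ℂ} (hρ : ρ.PosDef) :
    |(ρ * cfc Real.log ρ).trace.re| ≤ m + ∑ i, ∑ j, ‖ρ i j‖ ^ 2 := by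
  have hsa : IsSelfAdjoint ρ := hρ.isHermitian
  obtain ⟨w, hw0, hw⟩ := re_trace_cfc_eq_sum hρ.isHermitian
  have h1 := hw fun _ => 1
  have h2 := hw fun x => x * x
  rw [cfc_const_one ℝ ρ] at h1
  rw [cfc_mul (fun x : ℝ => x) (fun x => x) ρ (continuousOn_real_spectrum _ _)
        (continuousOn_real_spectrum _ _), cfc_id' ℝ ρ] at h2
  have h3 : (ρ * ρ).trace.re = ∑ i, ∑ j, ‖ρ i j‖ ^ 2 := by
    rw [← frob_self_eq_sum, frob, hρ.isHermitian.eq]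
  have h4 : (1 : Matrix (Fin m) (Fin m) ℂ).trace.re = m := by simp
  rw [← h3, ← h4, h1, h2, mul_cfc_log_eq hρ.isHermitian, hw, ← Finset.sum_add_distrib]
  refine (Finset.abs_sum_le_sum_abs _ _).trans (Finset.sum_le_sum fun i _ => ?_)
  rw [abs_mul, abs_of_nonneg (hw0 i), ← mul_add, ← sq]
  exact mul_le_mul_of_nonneg_left (abs_mul_log_le (hρ.eigenvalues_pos i)) (hw0 i)

theorem integrableOn_entropyDensity {ρ : P.HermL2} (hρ : ρ ∈ P.conePos) :
    IntegrableOn (P.entropyDensity ρ) P.S := by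
  have := P.isFiniteMeasure_restrict
  have hm := P.aestronglyMeasurable_re_trace_cfc ρ Real.continuous_mul_log
  have hb : Integrable (fun θ => (m : ℝ) + ∑ i, ∑ j, ‖ρ.1 θ i j‖ ^ 2) (volume.restrict P.S) :=
    (integrable_const _).add (integrable_finsetSum _ fun i _ => integrable_finsetSum _ fun j _ =>
      (ρ.2.1 i j).integrable_norm_pow (by norm_num))
  refine hb.mono' (hm.congr (P.ae_restrict_S fun θ hθ => ?_)) (P.ae_restrict_S fun θ hθ => ?_)
  · simp only [entropyDensity, mul_cfc_log_eq (ρ.2.2 θ hθ)]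
  · exact abs_re_trace_mul_log_le (hρ θ hθ)

/-! ### The adjoint of the moment operator -/

theorem frob_moment_integrand (lam : P.momentSpace) {ρ : Matrix (Fin m) (Fin m) ℂ}
    (hρ : ρ.IsHermitian) (θ : EuclideanSpace ℝ (Fin k)) :
    frob (lam : Matrix (Fin p) (Fin q) ℂ) (P.Gl θ * ρ * P.Gr θ) =
      (P.LStar lam θ * ρ).trace.re := by
  set N := (P.Gl θ)ᴴ * (lam : Matrix (Fin p) (Fin q) ℂ) * (P.Gr θ)ᴴ with hN
  have h : hermPart N = hermPart Nᴴ := by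
    rw [hermPart, hermPart, Matrix.conjTranspose_conjTranspose, add_comm]
  rw [LStar, h, re_trace_hermPart_mul _ hρ, hN]
  simp only [frob, Matrix.conjTranspose_mul, Matrix.conjTranspose_conjTranspose, Matrix.mul_assoc]
  rw [Matrix.trace_mul_comm (P.Gr θ)]
  simp only [Matrix.mul_assoc]

theorem coe_L_apply (ρ : P.HermL2) (i : Fin p) (j : Fin q) :
    (P.L ρ : Matrix (Fin p) (Fin q) ℂ) i j = ∫ θ in P.S, (P.Gl θ * ρ.1 θ * P.Gr θ) i j := rfl

theorem integrable_re_trace_LStar_mul (lam : P.momentSpace) (ρ : P.HermL2) :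
    IntegrableOn (fun θ => (P.LStar lam θ * ρ.1 θ).trace.re) P.S := by
  have h : Integrable (fun θ => ∑ i, ∑ j, (star ((lam : Matrix (Fin p) (Fin q) ℂ) i j) *
      (P.Gl θ * ρ.1 θ * P.Gr θ) i j).re) (volume.restrict P.S) :=
    integrable_finsetSum _ fun i _ => integrable_finsetSum _ fun j _ =>
      ((P.integrable_moment ρ i j).const_mul _).re
  refine h.congr (P.ae_restrict_S fun θ hθ => ?_)
  simp only [← P.frob_moment_integrand lam (ρ.2.2 θ hθ), frob_eq_sum]

theorem frob_L (lam : P.momentSpace) (ρ : P.HermL2) :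
    frob (lam : Matrix (Fin p) (Fin q) ℂ) (P.L ρ : Matrix (Fin p) (Fin q) ℂ) =
      ∫ θ in P.S, (P.LStar lam θ * ρ.1 θ).trace.re := by
  have hI : ∀ i j, Integrable (fun θ => star ((lam : Matrix (Fin p) (Fin q) ℂ) i j) *
      (P.Gl θ * ρ.1 θ * P.Gr θ) i j) (volume.restrict P.S) := fun i j =>
    (P.integrable_moment ρ i j).const_mul _
  have h : ∫ θ in P.S, (P.LStar lam θ * ρ.1 θ).trace.re = ∫ θ in P.S, ∑ i, ∑ j,
      (star ((lam : Matrix (Fin p) (Fin q) ℂ) i j) * (P.Gl θ * ρ.1 θ * P.Gr θ) i j).re :=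
    integral_congr_ae (P.ae_restrict_S fun θ hθ => by
      simp only [← P.frob_moment_integrand lam (ρ.2.2 θ hθ), frob_eq_sum])
  have hI' : ∀ i j, Integrable (fun θ => (star ((lam : Matrix (Fin p) (Fin q) ℂ) i j) *
      (P.Gl θ * ρ.1 θ * P.Gr θ) i j).re) (volume.restrict P.S) := fun i j => (hI i j).re
  rw [h, frob_eq_sum, integral_finsetSum _ fun i _ => integrable_finsetSum _ fun j _ => hI' i j]
  refine Finset.sum_congr rfl fun i _ => ?_
  rw [integral_finsetSum _ fun j _ => hI' i j]
  refine Finset.sum_congr rfl fun j _ => ?_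
  rw [coe_L_apply, ← integral_const_mul]
  exact (integral_re (hI i j)).symm

/-- Here multipliers must lie in the range of `L`: with `lam = L ρ`, the adjoint identity gives
`⟨lam, lam⟩ = ∫ Re tr(L*(lam) ρ) = 0`. -/
theorem eq_zero_of_LStar_ae_eq_zero {lam : P.momentSpace}
    (h : ∀ᵐ θ ∂(volume.restrict P.S), P.LStar lam θ = 0) : lam = 0 := by
  obtain ⟨ρ, hρ⟩ := lam.2
  have h0 := P.frob_L lam ρ
  have hL : (P.L ρ : Matrix (Fin p) (Fin q) ℂ) = lam := hρ
  rw [hL, integral_congr_ae (g := fun _ => (0 : ℝ))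
    (by filter_upwards [h] with θ hθ; simp [hθ]), integral_zero] at h0
  exact Subtype.ext (frob_self_eq_zero h0)

/-! ### Difference quotients of `κ` -/

theorem continuous_LStar_comp {X : Type*} [TopologicalSpace X] {f : X → P.momentSpace}
    {g : X → P.S} (hf : Continuous f) (hg : Continuous g) :
    Continuous fun x => P.LStar (f x) (g x) := by
  have h1 : Continuous fun θ : P.S => P.Gl θ := P.continuousOn_Gl.domRestrict
  have h2 : Continuous fun θ : P.S => P.Gr θ := P.continuousOn_Gr.domRestrict
  exact continuous_hermPart.comp (((h1.comp hg).matrix_conjTranspose.matrix_mul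
    (continuous_subtype_val.comp hf)).matrix_mul (h2.comp hg).matrix_conjTranspose)

/-- The kernels are continuous only on `S`, so the integral is moved to the compact subtype before
continuity in the parameter is invoked. -/
theorem continuous_L_comp {X : Type*} [TopologicalSpace X] [FirstCountableTopology X]
    [LocallyCompactSpace X] {f : X → P.HermL2}
    (hf : Continuous fun z : X × P.S => (f z.1).1 z.2) : Continuous fun x => P.L (f x) := by
  have h1 : Continuous fun θ : P.S => P.Gl θ := P.continuousOn_Gl.domRestrict
  have h2 : Continuous fun θ : P.S => P.Gr θ := P.continuousOn_Gr.domRestrict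
  have hfin : IsFiniteMeasure (Measure.comap (Subtype.val : P.S → _) volume) := by
    refine ⟨?_⟩
    rw [comap_subtype_coe_apply P.isCompact_S.measurableSet]
    simpa using P.isCompact_S.measure_lt_top
  have hc : CompactSpace P.S := isCompact_iff_compactSpace.1 P.isCompact_S
  refine Continuous.subtype_mk (f := fun x => (P.L (f x) : Matrix (Fin p) (Fin q) ℂ))
    (continuous_matrix fun i j => ?_) _
  simp only [coe_L_apply]
  simp only [← integral_subtype_comap P.isCompact_S.measurableSet]
  have h := continuous_parametric_integral_of_continuous (X := X)
    (μ := Measure.comap (Subtype.val : P.S → _) volume)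
    (f := fun x θ => (P.Gl θ * (f x).1 θ * P.Gr θ) i j)
    ((((h1.comp continuous_snd).matrix_mul hf).matrix_mul (h2.comp continuous_snd)).matrix_elem i j)
    isCompact_univ
  simpa only [Measure.restrict_univ] using h

/-- The averaged Jacobian of `κ` between `x` and `y`. -/
noncomputable def kappaSlope (x y : P.momentSpace) : Module.End ℝ P.momentSpace :=
  -((Real.exp 1)⁻¹ • (P.L ∘ₗ
    { toFun := fun δ => ⟨fun θ => hermPart (duhamel (-P.LStar x θ) (-P.LStar y θ) (P.LStar δ θ)),
        P.mem_HermL2_of_continuousOn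
          (continuousOn_iff_continuous_domRestrict.2
            (continuous_hermPart.comp (continuous_duhamel (P.continuous_LStar x).neg
              (P.continuous_LStar y).neg (P.continuous_LStar δ))))
          fun _ _ => hermPart_isHermitian _⟩
      map_add' := fun δ ε => Subtype.ext <| funext fun θ => by
        simp only [Submodule.coe_add, Pi.add_apply, LStar_add, duhamel_add, hermPart_add]
      map_smul' := fun c δ => Subtype.ext <| funext fun θ => by
        simp only [Submodule.coe_smul, Pi.smul_apply, LStar_smul, RingHom.id_apply,
          duhamel_smul, hermPart_smul] }))

theorem LStar_sub (lam mu : P.momentSpace) (θ : EuclideanSpace ℝ (Fin k)) :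
    P.LStar (lam - mu) θ = P.LStar lam θ - P.LStar mu θ := by
  rw [sub_eq_add_neg, ← neg_one_smul ℝ mu, LStar_add, LStar_smul, neg_one_smul, sub_eq_add_neg]

/-- On the diagonal the Duhamel integral is already Hermitian, so taking the Hermitian part changes
nothing. -/
theorem nablaKappa_eq_kappaSlope (x : P.momentSpace) : P.nablaKappa x = P.kappaSlope x x := by
  rw [nablaKappa, kappaSlope]
  congr 3
  refine LinearMap.ext fun δ => Subtype.ext <| funext fun θ => ?_
  have h := (P.LStar_isHermitian x θ).neg
  change scrambledMul _ _ = hermPart _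
  rw [← scrambledMul_exp_eq_duhamel h,
    hermPart_of_isHermitian (scrambledMul_exp_isHermitian h (P.LStar_isHermitian δ θ))]

/-- For distinct exponents the Duhamel integral of a general `δ` need not be Hermitian, hence
`hermPart` in the slope. At `δ = x - y` it is a difference of Hermitian exponentials up to sign, and
`hermPart` is harmless. -/
theorem kappa_sub_kappa (x y : P.momentSpace) :
    P.kappa x - P.kappa y = P.kappaSlope x y (x - y) := by
  rw [kappa, kappa, ← map_sub, kappaSlope, LinearMap.neg_apply, LinearMap.smul_apply,
    LinearMap.comp_apply, ← map_smul, ← map_neg]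
  congr 1
  refine Subtype.ext <| funext fun θ => ?_
  have hx := (P.LStar_isHermitian x θ).neg
  have hy := (P.LStar_isHermitian y θ).neg
  change (Real.exp 1)⁻¹ • NormedSpace.exp (-P.LStar x θ) -
    (Real.exp 1)⁻¹ • NormedSpace.exp (-P.LStar y θ) = -((Real.exp 1)⁻¹ • hermPart _)
  have hn : P.LStar (x - y) θ = (-1 : ℝ) • (-P.LStar x θ - -P.LStar y θ) := by
    rw [LStar_sub, neg_one_smul]; abel
  rw [← smul_sub, hn, duhamel_smul, ← exp_sub_exp_eq_duhamel,
    hermPart_of_isHermitian (smul_isHermitian _ (hx.exp.sub hy.exp)), neg_one_smul, smul_neg,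
    neg_neg]

theorem continuous_kappaSlope_apply (δ : P.momentSpace) :
    Continuous fun z : P.momentSpace × P.momentSpace => P.kappaSlope z.1 z.2 δ := by
  have hF : FirstCountableTopology P.momentSpace :=
    firstCountableTopology_of_normed P.momentSpace
  have hl : LocallyCompactSpace P.momentSpace :=
    locallyCompactSpace_of_finiteDimensional P.momentSpace
  refine Continuous.neg (Continuous.const_smul (P.continuous_L_comp ?_) _)
  have h1 : Continuous fun z : (P.momentSpace × P.momentSpace) × P.S => P.LStar z.1.1 z.2 :=
    P.continuous_LStar_comp (continuous_fst.comp continuous_fst) continuous_snd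
  have h2 : Continuous fun z : (P.momentSpace × P.momentSpace) × P.S => P.LStar z.1.2 z.2 :=
    P.continuous_LStar_comp (continuous_snd.comp continuous_fst) continuous_snd
  have h3 : Continuous fun z : (P.momentSpace × P.momentSpace) × P.S => P.LStar δ z.2 :=
    P.continuous_LStar_comp continuous_const continuous_snd
  exact continuous_hermPart.comp (continuous_duhamel h1.neg h2.neg h3)

theorem frob_kappaSlope (x y δ : P.momentSpace) :
    frob (δ : Matrix (Fin p) (Fin q) ℂ) (P.kappaSlope x y δ : Matrix (Fin p) (Fin q) ℂ) =
      -((Real.exp 1)⁻¹ * ∫ θ in P.S, (P.LStar δ θ *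
        hermPart (duhamel (-P.LStar x θ) (-P.LStar y θ) (P.LStar δ θ))).trace.re) := by
  rw [kappaSlope, LinearMap.neg_apply, LinearMap.smul_apply, LinearMap.comp_apply,
    Submodule.coe_neg, Submodule.coe_smul, frob_neg_right, frob_smul_right, frob_L]
  rfl

theorem kappaSlope_injective (x y : P.momentSpace) :
    Function.Injective (P.kappaSlope x y) := by
  rw [injective_iff_map_eq_zero]
  intro δ hδ
  -- Pairing with the Hermitian matrix `L*(δ)` ignores the anti-Hermitian part, so `hermPart` may be
  -- dropped.
  have hcomm : ∀ θ, (P.LStar δ θ *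
      hermPart (duhamel (-P.LStar x θ) (-P.LStar y θ) (P.LStar δ θ))).trace.re =
      (P.LStar δ θ * duhamel (-P.LStar x θ) (-P.LStar y θ) (P.LStar δ θ)).trace.re := fun θ => by
    rw [Matrix.trace_mul_comm, re_trace_hermPart_mul _ (P.LStar_isHermitian δ θ),
      Matrix.trace_mul_comm]
  have h := P.frob_kappaSlope x y δ
  have h2 := P.integrable_re_trace_LStar_mul δ
    ⟨fun θ => hermPart (duhamel (-P.LStar x θ) (-P.LStar y θ) (P.LStar δ θ)),
      P.mem_HermL2_of_continuousOn (continuousOn_iff_continuous_domRestrict.2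
        (continuous_hermPart.comp (continuous_duhamel (P.continuous_LStar x).neg
          (P.continuous_LStar y).neg (P.continuous_LStar δ)))) fun _ _ => hermPart_isHermitian _⟩
  rw [hδ, Submodule.coe_zero, frob_zero_right, eq_comm, neg_eq_zero, mul_eq_zero,
    or_iff_right (by positivity)] at h
  simp only [hcomm] at h h2
  rw [integral_eq_zero_iff_of_nonneg (fun θ => re_trace_mul_duhamel_nonneg
    (P.LStar_isHermitian x θ).neg (P.LStar_isHermitian y θ).neg (P.LStar_isHermitian δ θ)) h2] at h
  refine P.eq_zero_of_LStar_ae_eq_zero ?_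
  filter_upwards [h] with θ hθ
  exact eq_zero_of_re_trace_mul_duhamel (P.LStar_isHermitian x θ).neg
    (P.LStar_isHermitian y θ).neg (P.LStar_isHermitian δ θ) hθ

theorem kappa_injective : Function.Injective P.kappa := by
  intro x y h
  have h1 := P.kappa_sub_kappa x y
  rw [h, sub_self, eq_comm] at h1
  exact sub_eq_zero.1 ((injective_iff_map_eq_zero _).1 (P.kappaSlope_injective x y) _ h1)

theorem isUnit_nablaKappa (x : P.momentSpace) : IsUnit (P.nablaKappa x) := by
  rw [nablaKappa_eq_kappaSlope, LinearMap.isUnit_iff_ker_eq_bot, LinearMap.ker_eq_bot]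
  exact P.kappaSlope_injective x x

theorem hasStrictFDerivAt_kappa (x : P.momentSpace) :
    HasStrictFDerivAt P.kappa (LinearMap.toContinuousLinearMap (P.nablaKappa x)) x := by
  rw [nablaKappa_eq_kappaSlope]
  exact hasStrictFDerivAt_of_slope P.continuous_kappaSlope_apply P.kappa_sub_kappa x

end MomentData

/-! ### Range of a coercive map and its Newton flow in finite dimension. -/

section Flow

variable {E : Type*} [NormedAddCommGroup E] [NormedSpace ℝ E]

/-- The point reached at time `t` on the straight line along which `f` of a solution moves. -/
noncomputable def decayLine (R y : E) (t : ℝ) : E := R + Real.exp (-t) • (y - R)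

theorem decayLine_zero (R y : E) : decayLine R y 0 = y := by simp [decayLine]

theorem hasDerivAt_decayLine (R y : E) (t : ℝ) :
    HasDerivAt (decayLine R y) (R - decayLine R y t) t := by
  have h := (((hasDerivAt_neg t).exp).smul_const (y - R)).const_add R
  refine h.congr_deriv ?_
  simp [decayLine]

theorem continuous_decayLine (R y : E) : Continuous (decayLine R y) := by
  unfold decayLine; fun_prop

theorem tendsto_decayLine (R y : E) : Tendsto (decayLine R y) atTop (𝓝 R) := by
  have h := ((Real.tendsto_exp_neg_atTop_nhds_zero).smul_const (y - R)).const_add R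
  rw [zero_smul, add_zero] at h
  exact h

theorem decayLine_mem_of_le {U : Set E} (hU : Convex ℝ U) {R y : E} (hy : y ∈ U) {s t : ℝ}
    (hs : 0 ≤ s) (hst : s ≤ t) (ht : decayLine R y t ∈ U) : decayLine R y s ∈ U := by
  have hconv : Convex ℝ (AffineMap.lineMap R y ⁻¹' U : Set ℝ) := hU.affine_preimage _
  have he : ∀ r : ℝ, AffineMap.lineMap R y r = R + r • (y - R) := fun r => by
    rw [AffineMap.lineMap_apply, vsub_eq_sub, vadd_eq_add, add_comm]
  have h1 : Real.exp (-t) ∈ (AffineMap.lineMap R y ⁻¹' U : Set ℝ) := by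
    rw [mem_preimage, he]; exact ht
  have h2 : (1 : ℝ) ∈ (AffineMap.lineMap R y ⁻¹' U : Set ℝ) := by
    rw [mem_preimage, he]; simpa using hy
  have h3 := hconv.ordConnected.out h1 h2
    (show Real.exp (-s) ∈ Icc (Real.exp (-t)) 1 from
      ⟨Real.exp_le_exp.2 (by linarith), Real.exp_le_one_iff.2 (by linarith)⟩)
  rw [mem_preimage, he] at h3
  exact h3

theorem decayLine_mem {U : Set E} (hU : Convex ℝ U) {R y : E} (hy : y ∈ U) (hR : R ∈ U) {t : ℝ}
    (ht : 0 ≤ t) : decayLine R y t ∈ U := by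
  have h : decayLine R y t = (1 - Real.exp (-t)) • R + Real.exp (-t) • y := by
    rw [decayLine]; module
  rw [h]
  exact hU hR hy (sub_nonneg.2 (Real.exp_le_one_iff.2 (by linarith))) (Real.exp_pos _).le
    (by ring)

/-- The time at which the line leaves the open convex set `U`. -/
theorem exists_exit_time {U : Set E} (hU : Convex ℝ U) (hUo : IsOpen U) (R : E) {y : E}
    (hy : y ∈ U) : ∃ T : EReal, 0 < T ∧
      ∀ t : ℝ, 0 ≤ t → ((t : EReal) < T ↔ decayLine R y t ∈ U) := by
  -- By openness the set of times spent in `U` has no largest element, so its supremum in `EReal` is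
  -- not attained; by convexity, every earlier nonnegative time belongs to it.
  have hnext : ∀ t : ℝ, decayLine R y t ∈ U → ∃ t', t < t' ∧ decayLine R y t' ∈ U := by
    intro t ht
    have h1 : ∀ᶠ t' in 𝓝[>] t, decayLine R y t' ∈ U :=
      ((continuous_decayLine R y).tendsto t).mono_left nhdsWithin_le_nhds
        |>.eventually (hUo.mem_nhds ht)
    exact (h1.and self_mem_nhdsWithin).exists.imp fun t' h => ⟨h.2, h.1⟩
  have hmem : ∀ t : ℝ, 0 ≤ t → decayLine R y t ∈ U →
      (t : EReal) < sSup ((fun t : ℝ => (t : EReal)) '' {t | 0 ≤ t ∧ decayLine R y t ∈ U}) := by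
    intro t ht htU
    obtain ⟨t', htt', ht'⟩ := hnext t htU
    exact (EReal.coe_lt_coe_iff.2 htt').trans_le (le_sSup ⟨t', ⟨ht.trans htt'.le, ht'⟩, rfl⟩)
  refine ⟨_, ?_, fun t ht => ⟨fun h => ?_, hmem t ht⟩⟩
  · exact_mod_cast hmem 0 le_rfl ((decayLine_zero R y).symm ▸ hy)
  · obtain ⟨_, ⟨t', ⟨-, ht'⟩, rfl⟩, htt'⟩ := lt_sSup_iff.1 h
    exact decayLine_mem_of_le hU hy ht (EReal.coe_lt_coe_iff.1 htt').le ht'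

variable [FiniteDimensional ℝ E]

/-- A map onto an open subset of a convex set `K`, satisfying one-sided bounds against a dense
subset of `K`, fills the interior of `K`. -/
theorem range_eq_interior_of_coercive {K D : Set E} {f : E → E} (pair : E →ₗ[ℝ] E →ₗ[ℝ] ℝ)
    (hpair : Continuous fun z : E × E => pair z.1 z.2) (hpos : ∀ u, u ≠ 0 → 0 < pair u u)
    (hK : Convex ℝ K) (hf : Continuous f) (hopen : IsOpen (range f)) (hsub : range f ⊆ K)
    (hD : K ⊆ closure D) (hbd : ∀ x ∈ D, ∃ C, ∀ l, pair l (f l - x) ≤ C) :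
    range f = interior K := by
  have hint : range f ⊆ interior K := interior_maximal hsub hopen
  have := FiniteDimensional.proper_real E
  -- The interior of `K` is connected and the range is open and nonempty, so it suffices that the
  -- range is relatively closed there.
  refine hint.antisymm (IsPreconnected.subset_of_closure_inter_subset
    hK.interior.isPreconnected hopen ⟨f 0, hint (mem_range_self 0), mem_range_self 0⟩ ?_)
  rintro R ⟨hR, hRK⟩
  obtain ⟨y, hy, hyR⟩ := mem_closure_iff_seq_limit.1 hR
  choose l hl using hy
  by_cases hb : ∃ B, ∃ᶠ n in atTop, ‖l n‖ ≤ B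
  · obtain ⟨B, hB⟩ := hb
    have hc : IsClosed (f '' Metric.closedBall 0 B) :=
      ((isCompact_closedBall 0 B).image hf).isClosed
    exact image_subset_range _ _ (hc.mem_of_frequently_of_tendsto
      (hB.mono fun n hn => ⟨l n, by simpa using hn, hl n⟩) hyR)
  exfalso
  have hinf : Tendsto (fun n => ‖l n‖) atTop atTop := by
    refine tendsto_atTop.2 fun B => ?_
    by_contra h
    exact hb ⟨B, (not_eventually.1 h).mono fun n hn => (not_le.1 hn).le⟩
  -- The preimages escape to infinity; take a limit `u` of their directions.
  obtain ⟨u, -, φ, hφ, hu⟩ := (isCompact_closedBall (0 : E) 1).tendsto_subseq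
    (x := fun n => ‖l n‖⁻¹ • l n) fun n => by
      rw [mem_closedBall_zero_iff, norm_smul, norm_inv, norm_norm]
      exact inv_mul_le_one
  have hinfφ := hinf.comp hφ.tendsto_atTop
  have hu1 : ‖u‖ = 1 := by
    refine tendsto_nhds_unique hu.norm (tendsto_const_nhds.congr' ?_)
    filter_upwards [hinfφ.eventually_gt_atTop 0] with n hn
    have hn' : ‖l (φ n)‖ ≠ 0 := ne_of_gt hn
    simp only [Function.comp_apply, norm_smul, norm_inv, norm_norm]
    rw [inv_mul_cancel₀ hn']
  have hu0 : u ≠ 0 := fun h => by simp [h] at hu1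
  have hR' : Tendsto (fun d : ℝ => R - d • u) (𝓝[>] 0) (𝓝 R) := by
    have h : Continuous fun d : ℝ => R - d • u := by fun_prop
    simpa using (h.tendsto 0).mono_left nhdsWithin_le_nhds
  obtain ⟨d, hd, hd0⟩ := ((hR'.eventually (mem_interior_iff_mem_nhds.1 hRK)).and
    self_mem_nhdsWithin).exists
  -- Since `R` is interior, `R - d • u` is still in `K` for some `d > 0`; density gives `x ∈ D` with
  -- `pair u (R - x) > 0`. Dividing the bound `C` by `‖l n‖` forces this number to be at most `0`.
  have hV : IsOpen {x | 0 < pair u (R - x)} := isOpen_lt continuous_const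
    (hpair.comp (f := fun x => (u, R - x)) (by fun_prop))
  obtain ⟨x, hx, hxD⟩ := mem_closure_iff.1 (hD hd) _ hV (by
    simp only [mem_ofPred_eq, sub_sub_cancel, map_smul, smul_eq_mul]
    exact mul_pos hd0 (hpos u hu0))
  obtain ⟨C, hC⟩ := hbd x hxD
  have hlim : Tendsto (fun n => pair (‖l (φ n)‖⁻¹ • l (φ n)) (y (φ n) - x)) atTop
      (𝓝 (pair u (R - x))) :=
    (hpair.tendsto (u, R - x)).comp (hu.prodMk_nhds ((hyR.comp hφ.tendsto_atTop).sub_const x))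
  have h0 : Tendsto (fun n => ‖l (φ n)‖⁻¹ * C) atTop (𝓝 0) := by
    simpa using (tendsto_inv_atTop_zero.comp hinfφ).mul_const C
  refine absurd (le_of_tendsto_of_tendsto' hlim h0 fun n => ?_) (not_le.2 hx)
  rw [map_smul, LinearMap.smul_apply, smul_eq_mul, ← hl]
  exact mul_le_mul_of_nonneg_left (hC _) (by positivity)

variable {f : E → E} {A : E → Module.End ℝ E}

/-- The inverse function theorem; injectivity makes `Function.invFun f` a left inverse everywhere,
so it is the local inverse. -/
theorem hasFDerivAt_of_isUnit
    (hf : ∀ x, HasStrictFDerivAt f (LinearMap.toContinuousLinearMap (A x)) x)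
    (hA : ∀ x, IsUnit (A x)) (hinj : Function.Injective f) (x : E) :
    range f ∈ 𝓝 (f x) ∧
      HasFDerivAt (Function.invFun f) (LinearMap.toContinuousLinearMap (Ring.inverse (A x))) (f x) := by
  obtain ⟨v, hv⟩ := hA x
  let e : E ≃L[ℝ] E := ContinuousLinearEquiv.equivOfInverse
    (LinearMap.toContinuousLinearMap (v : Module.End ℝ E))
    (LinearMap.toContinuousLinearMap ((v⁻¹ : (Module.End ℝ E)ˣ) : Module.End ℝ E))
    (fun y => by
      change ((v⁻¹ : (Module.End ℝ E)ˣ) * v : Module.End ℝ E) y = y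
      rw [Units.inv_mul]; rfl)
    (fun y => by
      change (v * (v⁻¹ : (Module.End ℝ E)ˣ) : Module.End ℝ E) y = y
      rw [Units.mul_inv]; rfl)
  have he : HasStrictFDerivAt f (e : E →L[ℝ] E) x := by
    have h := hf x
    rw [← hv] at h
    exact h
  refine ⟨he.map_nhds_eq_of_equiv ▸ range_mem_map, ?_⟩
  rw [← hv, Ring.inverse_unit]
  exact (he.to_local_left_inverse (g := Function.invFun f)
    (Eventually.of_forall (Function.leftInverse_invFun hinj))).hasFDerivAt

theorem isOpen_range_of_isUnit
    (hf : ∀ x, HasStrictFDerivAt f (LinearMap.toContinuousLinearMap (A x)) x)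
    (hA : ∀ x, IsUnit (A x)) (hinj : Function.Injective f) : IsOpen (range f) := by
  rw [isOpen_iff_mem_nhds]
  rintro _ ⟨x, rfl⟩
  exact (hasFDerivAt_of_isUnit hf hA hinj x).1

/-- Along a solution of the Newton flow, `f` moves on a straight line. -/
theorem eq_decayLine_of_newton_flow
    (hf : ∀ x, HasStrictFDerivAt f (LinearMap.toContinuousLinearMap (A x)) x)
    (hA : ∀ x, IsUnit (A x)) {R : E} {l : ℝ → E} {T : EReal}
    (hl : ∀ t : ℝ, 0 ≤ t → (t : EReal) < T →
      HasDerivWithinAt l (Ring.inverse (A (l t)) (R - f (l t))) (Ici 0) t)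
    {t : ℝ} (ht : 0 ≤ t) (htT : (t : EReal) < T) :
    f (l t) = decayLine R (f (l 0)) t := by
  have hd : ∀ s ∈ Icc 0 t, HasDerivWithinAt (fun s => f (l s)) (R - f (l s)) (Ici 0) s := by
    intro s hs
    have h := (hf (l s)).hasFDerivAt.comp_hasDerivWithinAt s
      (hl s hs.1 ((EReal.coe_le_coe_iff.2 hs.2).trans_lt htT))
    refine h.congr_deriv ?_
    change (A (l s) * Ring.inverse (A (l s))) (R - f (l s)) = _
    rw [Ring.mul_inverse_cancel _ (hA _)]
    rfl
  -- Integrating factor: `e^s (f(l s) - R)` has zero derivative.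
  have hg : ∀ s ∈ Icc 0 t,
      HasDerivWithinAt (fun s => Real.exp s • (f (l s) - R)) 0 (Ici 0) s := by
    intro s hs
    refine ((Real.hasDerivAt_exp s).hasDerivWithinAt.smul ((hd s hs).sub_const R)).congr_deriv ?_
    module
  have h := constant_of_has_deriv_right_zero (a := 0) (b := t)
    (fun s hs => ((hg s hs).continuousWithinAt).mono Icc_subset_Ici_self)
    (fun s hs => (hg s ⟨hs.1, hs.2.le⟩).mono (Ici_subset_Ici.2 hs.1)) t ⟨ht, le_rfl⟩
  simp only [Real.exp_zero, one_smul] at h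
  rw [decayLine, ← h, smul_smul, ← Real.exp_add, neg_add_cancel, Real.exp_zero, one_smul]
  abel

/-- The lift of a straight line through `f` solves the Newton flow. -/
theorem hasDerivAt_invFun_decayLine
    (hf : ∀ x, HasStrictFDerivAt f (LinearMap.toContinuousLinearMap (A x)) x)
    (hA : ∀ x, IsUnit (A x)) (hinj : Function.Injective f) {R y : E} {t : ℝ}
    (ht : decayLine R y t ∈ range f) :
    HasDerivAt (fun s => Function.invFun f (decayLine R y s))
      (Ring.inverse (A (Function.invFun f (decayLine R y t)))
        (R - f (Function.invFun f (decayLine R y t)))) t := by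
  obtain ⟨x, hx⟩ := ht
  have hi : Function.invFun f (decayLine R y t) = x := by
    rw [← hx]; exact Function.leftInverse_invFun hinj x
  have h := (hasFDerivAt_of_isUnit hf hA hinj x).2
  rw [hx] at h
  rw [hi, hx]
  exact h.comp_hasDerivAt t (hasDerivAt_decayLine R y t)

/-- Late times use the linear bound from differentiability of the inverse at `f x`, since the line
is at distance `e^{-t}‖y - f x‖` from `f x`. Times up to `N` use compactness, with the factor `e^t`
built into the bounded function. -/
theorem norm_invFun_decayLine_sub_le
    (hf : ∀ x, HasStrictFDerivAt f (LinearMap.toContinuousLinearMap (A x)) x)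
    (hA : ∀ x, IsUnit (A x)) (hinj : Function.Injective f) {y : E} (x : E)
    (hmem : ∀ t, 0 ≤ t → decayLine (f x) y t ∈ range f) :
    ∃ C : ℝ, 0 ≤ C ∧ ∀ t : ℝ, 0 ≤ t →
      ‖Function.invFun f (decayLine (f x) y t) - x‖ ≤ C * Real.exp (-t) := by
  have hi : Function.invFun f (f x) = x := Function.leftInverse_invFun hinj x
  obtain ⟨c, hc⟩ := ((hasFDerivAt_of_isUnit hf hA hinj x).2.isBigO_sub).bound
  have hev := (tendsto_decayLine (f x) y).eventually hc
  obtain ⟨N, hN⟩ := eventually_atTop.1 hev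
  have hcont : ContinuousOn (fun t => Real.exp t * ‖Function.invFun f (decayLine (f x) y t) - x‖)
      (Icc 0 N) := fun t ht => (Real.continuous_exp.continuousAt.mul
        ((hasDerivAt_invFun_decayLine hf hA hinj (hmem t ht.1)).continuousAt.sub
          continuousAt_const).norm).continuousWithinAt
  obtain ⟨C', hC'⟩ := isCompact_Icc.exists_bound_of_continuousOn hcont
  refine ⟨max 0 (max C' (c * ‖y - f x‖)), le_max_left _ _, fun t ht => ?_⟩
  rcases le_total t N with htN | htN
  · have h := (le_abs_self _).trans (hC' t ⟨ht, htN⟩)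
    calc _ = Real.exp t * ‖Function.invFun f (decayLine (f x) y t) - x‖ * Real.exp (-t) := by
          rw [mul_comm (Real.exp t), mul_assoc, ← Real.exp_add, add_neg_cancel, Real.exp_zero,
            mul_one]
      _ ≤ _ := mul_le_mul_of_nonneg_right (h.trans ((le_max_left _ _).trans (le_max_right _ _)))
          (Real.exp_pos _).le
  · have h := hN t htN
    rw [hi, decayLine, add_sub_cancel_left, norm_smul, Real.norm_of_nonneg (Real.exp_pos _).le]
      at h
    calc _ ≤ _ := h
      _ = c * ‖y - f x‖ * Real.exp (-t) := by ring
      _ ≤ _ := mul_le_mul_of_nonneg_right ((le_max_right _ _).trans (le_max_right _ _))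
          (Real.exp_pos _).le

/-- If the target is outside the range, the lift blows up at the exit time. -/
theorem norm_invFun_decayLine_unbounded (hf : Continuous f) {R y : E} (hR : R ∉ range f)
    {T : EReal} (hT0 : 0 < T)
    (hT : ∀ t : ℝ, 0 ≤ t → ((t : EReal) < T ↔ decayLine R y t ∈ range f)) (B : ℝ) :
    ∃ t₀ : ℝ, (t₀ : EReal) < T ∧ ∀ t : ℝ, 0 ≤ t → t₀ ≤ t → (t : EReal) < T →
      B < ‖Function.invFun f (decayLine R y t)‖ := by
  by_contra! hcon
  have := FiniteDimensional.proper_real E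
  -- Otherwise the line meets this compact part of the range at times arbitrarily close to `T`. For
  -- `T = ⊤` its limit `R` would be in the range; for finite `T`, so would the point at time `T`,
  -- against the definition of the exit time.
  have hZ : IsClosed (f '' Metric.closedBall 0 B) :=
    ((isCompact_closedBall 0 B).image hf).isClosed
  have hcon' : ∀ t₀ : ℝ, (t₀ : EReal) < T → ∃ t : ℝ, t₀ ≤ t ∧ (t : EReal) < T ∧
      decayLine R y t ∈ f '' Metric.closedBall 0 B := by
    intro t₀ ht₀
    obtain ⟨t, ht, htt, htT, hB⟩ := hcon t₀ ht₀
    exact ⟨t, htt, htT, _, by simpa using hB, Function.invFun_eq ((hT t ht).1 htT)⟩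
  induction T with
  | bot => simp at hT0
  | top =>
    refine hR (image_subset_range _ _ (hZ.mem_of_frequently_of_tendsto ?_
      (tendsto_decayLine R y)))
    exact frequently_atTop.2 fun t₀ => (hcon' t₀ (EReal.coe_lt_top _)).imp fun t h => ⟨h.1, h.2.2⟩
  | coe T =>
    have hpos : 0 ≤ T := by exact_mod_cast hT0.le
    have hcl : IsClosed (decayLine R y ⁻¹' (f '' Metric.closedBall 0 B)) :=
      hZ.preimage (continuous_decayLine R y)
    have hTm : T ∈ decayLine R y ⁻¹' (f '' Metric.closedBall 0 B) := by
      rw [← hcl.closure_eq, Metric.mem_closure_iff]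
      intro ε hε
      obtain ⟨t, h1, h2, h3⟩ := hcon' (T - ε / 2) (EReal.coe_lt_coe_iff.2 (by linarith))
      have h2' : t < T := EReal.coe_lt_coe_iff.1 h2
      refine ⟨t, h3, ?_⟩
      rw [Real.dist_eq, abs_of_pos (by linarith)]
      linarith
    exact lt_irrefl _ ((hT T hpos).2 (image_subset_range _ _ hTm))

end Flow

namespace MomentData

variable {k m p q : ℕ} (P : MomentData k m p q)

/-! ### Duality between the entropy and the exponential family -/

theorem rhoExp_mem_conePos (lam : P.momentSpace) : P.rhoExp lam ∈ P.conePos := fun θ _ =>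
  (posDef_exp (P.LStar_isHermitian lam θ).neg).smul (inv_pos.2 (Real.exp_pos 1))

/-- The total mass `∫_S trace ρ dθ`. -/
noncomputable def mass (ρ : P.HermL2) : ℝ := ∫ θ in P.S, (ρ.1 θ).trace.re

theorem integrableOn_re_trace (ρ : P.HermL2) : IntegrableOn (fun θ => (ρ.1 θ).trace.re) P.S := by
  have := P.isFiniteMeasure_restrict
  have h : Integrable (fun θ => (ρ.1 θ).trace) (volume.restrict P.S) := by
    simp only [Matrix.trace, Matrix.diag_apply]
    exact integrable_finsetSum _ fun i _ => (ρ.2.1 i i).integrable (by norm_num)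
  exact h.re

/-- The pointwise duality gap between a density and an exponential density. -/
noncomputable def dualityGap (ρ : P.HermL2) (lam : P.momentSpace)
    (θ : EuclideanSpace ℝ (Fin k)) : ℝ :=
  P.entropyDensity ρ θ + (P.LStar lam θ * ρ.1 θ).trace.re + ((P.rhoExp lam).1 θ).trace.re

theorem integrableOn_dualityGap {ρ : P.HermL2} (hρ : ρ ∈ P.conePos) (lam : P.momentSpace) :
    IntegrableOn (P.dualityGap ρ lam) P.S :=
  ((P.integrableOn_entropyDensity hρ).add (P.integrable_re_trace_LStar_mul lam ρ)).add
    (P.integrableOn_re_trace _)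

theorem integral_dualityGap {ρ : P.HermL2} (hρ : ρ ∈ P.conePos) (lam : P.momentSpace) :
    ∫ θ in P.S, P.dualityGap ρ lam θ = P.entropy ρ +
      frob (lam : Matrix (Fin p) (Fin q) ℂ) (P.L ρ : Matrix (Fin p) (Fin q) ℂ) +
        P.mass (P.rhoExp lam) := by
  have h1 := P.integrableOn_entropyDensity hρ
  have h2 := P.integrable_re_trace_LStar_mul lam ρ
  have h12 : IntegrableOn
      (fun θ => P.entropyDensity ρ θ + (P.LStar lam θ * ρ.1 θ).trace.re) P.S := h1.add h2
  rw [frob_L, entropy, mass, ← integral_add h1 h2,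
    ← integral_add h12 (P.integrableOn_re_trace _)]
  rfl

theorem dualityGap_nonneg {ρ : P.HermL2} (hρ : ρ ∈ P.conePos) (lam : P.momentSpace) :
    ∀ θ ∈ P.S, 0 ≤ P.dualityGap ρ lam θ := fun θ hθ =>
  (klein_inequality (hρ θ hθ) (P.LStar_isHermitian lam θ)).1

/-- Weak duality, by integrating Klein's inequality: every multiplier yields a lower bound on the
entropy that depends on `ρ` only through `L ρ`. -/
theorem entropy_add_nonneg {ρ : P.HermL2} (hρ : ρ ∈ P.conePos) (lam : P.momentSpace) :
    0 ≤ P.entropy ρ +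
      frob (lam : Matrix (Fin p) (Fin q) ℂ) (P.L ρ : Matrix (Fin p) (Fin q) ℂ) +
        P.mass (P.rhoExp lam) := by
  rw [← P.integral_dualityGap hρ]
  exact integral_nonneg_of_ae (P.ae_restrict_S (P.dualityGap_nonneg hρ lam))

theorem ae_eq_rhoExp {ρ : P.HermL2} (hρ : ρ ∈ P.conePos) (lam : P.momentSpace)
    (h : P.entropy ρ +
      frob (lam : Matrix (Fin p) (Fin q) ℂ) (P.L ρ : Matrix (Fin p) (Fin q) ℂ) +
        P.mass (P.rhoExp lam) ≤ 0) :
    ρ.1 =ᵐ[volume.restrict P.S] (P.rhoExp lam).1 := by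
  have h0 := h.antisymm (P.entropy_add_nonneg hρ lam)
  rw [← P.integral_dualityGap hρ, integral_eq_zero_iff_of_nonneg_ae
    (P.ae_restrict_S (P.dualityGap_nonneg hρ lam)) (P.integrableOn_dualityGap hρ lam)] at h0
  filter_upwards [h0, P.ae_restrict_S hρ] with θ hθ hpos
  exact (klein_inequality hpos (P.LStar_isHermitian lam θ)).2 hθ

theorem entropy_rhoExp_add (lam : P.momentSpace) :
    P.entropy (P.rhoExp lam) +
      frob (lam : Matrix (Fin p) (Fin q) ℂ) (P.kappa lam : Matrix (Fin p) (Fin q) ℂ) +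
        P.mass (P.rhoExp lam) = 0 := by
  rw [kappa, ← P.integral_dualityGap (P.rhoExp_mem_conePos lam)]
  exact integral_eq_zero_of_ae (Eventually.of_forall fun θ =>
    klein_equality (P.LStar_isHermitian lam θ))

/-- One-sided bound for the pairing of a multiplier with the moments of its exponential density. -/
theorem frob_kappa_sub_le {ρ : P.HermL2} (hρ : ρ ∈ P.conePos) (lam : P.momentSpace) :
    frob (lam : Matrix (Fin p) (Fin q) ℂ)
        ((P.kappa lam - P.L ρ : P.momentSpace) : Matrix (Fin p) (Fin q) ℂ) ≤
      P.entropy ρ + P.mass (P.rhoExp 0) := by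
  -- `h1` and `h2` bound the pairing by `S(ρ) - S(rhoExp lam)`; weak duality with multiplier `0`
  -- bounds the last entropy below independently of `lam`.
  have h1 := P.entropy_add_nonneg hρ lam
  have h2 := P.entropy_rhoExp_add lam
  have h3 := P.entropy_add_nonneg (P.rhoExp_mem_conePos lam) 0
  have h4 : frob ((0 : P.momentSpace) : Matrix (Fin p) (Fin q) ℂ)
      (P.L (P.rhoExp lam) : Matrix (Fin p) (Fin q) ℂ) = 0 := by
    simp [frob]
  rw [Submodule.coe_sub, frob_sub_right]
  linarith

/-! ### The image of `κ` -/

/-- The real Frobenius pairing on the space of moments. -/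
noncomputable def momentPairing : P.momentSpace →ₗ[ℝ] P.momentSpace →ₗ[ℝ] ℝ :=
  LinearMap.mk₂ ℝ (fun x y => frob (x : Matrix (Fin p) (Fin q) ℂ) (y : Matrix (Fin p) (Fin q) ℂ))
    (fun _ _ _ => frob_add_left _ _ _) (fun c _ _ => frob_smul_left c _ _)
    (fun _ _ _ => frob_add_right _ _ _) (fun c _ _ => frob_smul_right c _ _)

theorem momentPairing_apply (x y : P.momentSpace) : P.momentPairing x y =
    frob (x : Matrix (Fin p) (Fin q) ℂ) (y : Matrix (Fin p) (Fin q) ℂ) := rfl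

theorem continuous_momentPairing :
    Continuous fun z : P.momentSpace × P.momentSpace => P.momentPairing z.1 z.2 := by
  simp only [momentPairing_apply]
  have h1 : Continuous fun z : P.momentSpace × P.momentSpace =>
      (z.1 : Matrix (Fin p) (Fin q) ℂ) := continuous_subtype_val.comp continuous_fst
  have h2 : Continuous fun z : P.momentSpace × P.momentSpace =>
      (z.2 : Matrix (Fin p) (Fin q) ℂ) := continuous_subtype_val.comp continuous_snd
  exact Complex.continuous_re.comp (h1.matrix_conjTranspose.matrix_mul h2).matrix_trace

theorem convex_K : Convex ℝ P.K := by
  refine Convex.closure (Convex.linear_image (fun a ha b hb s t hs ht _ θ hθ => ?_) P.L)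
  exact ((ha θ hθ).smul hs).add ((hb θ hθ).smul ht)

/-- Adding a small positive multiple of `rhoExp 0` makes a semidefinite density positive definite
and moves its moment little. -/
theorem K_subset_closure_image_conePos : P.K ⊆ closure (P.L '' P.conePos) := by
  refine closure_minimal ?_ isClosed_closure
  rintro _ ⟨ρ, hρ, rfl⟩
  have h : Continuous fun d : ℝ => P.L ρ + d • P.kappa 0 :=
    continuous_const.add (continuous_id.smul continuous_const)
  have h0 : Tendsto (fun d : ℝ => P.L ρ + d • P.kappa 0) (𝓝[>] 0) (𝓝 (P.L ρ)) := by
    have h1 := (h.tendsto 0).mono_left (nhdsWithin_le_nhds (s := Ioi 0))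
    rwa [zero_smul, add_zero] at h1
  refine mem_closure_of_tendsto h0 ?_
  filter_upwards [self_mem_nhdsWithin] with d hd
  refine ⟨ρ + d • P.rhoExp 0, fun θ hθ => ?_, by rw [map_add, map_smul]; rfl⟩
  have h2 : (d • (P.rhoExp 0).1 θ).PosDef := (P.rhoExp_mem_conePos 0 θ hθ).smul hd
  exact Matrix.PosDef.posSemidef_add (hρ θ hθ) h2

theorem range_kappa : range P.kappa = interior P.K := by
  refine range_eq_interior_of_coercive (D := P.L '' P.conePos) P.momentPairing
    P.continuous_momentPairing (fun u hu => frob_self_pos fun h => hu (Subtype.ext h)) P.convex_K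
    (continuous_iff_continuousAt.2 fun x => (P.hasStrictFDerivAt_kappa x).continuousAt)
    (isOpen_range_of_isUnit P.hasStrictFDerivAt_kappa P.isUnit_nablaKappa P.kappa_injective)
    ?_ P.K_subset_closure_image_conePos ?_
  · rintro _ ⟨x, rfl⟩
    exact subset_closure ⟨_, fun θ hθ => (P.rhoExp_mem_conePos x θ hθ).posSemidef, rfl⟩
  · rintro _ ⟨ρ, hρ, rfl⟩
    exact ⟨_, P.frob_kappa_sub_le hρ⟩

/-! ### The maximal solution -/

/-- The preimage under `κ` of the straight line from `κ(lam0)` to `R`. -/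
noncomputable def newtonFlow (R lam0 : P.momentSpace) (t : ℝ) : P.momentSpace :=
  Function.invFun P.kappa (decayLine R (P.kappa lam0) t)

/-- Uniqueness needs no Lipschitz estimate: `κ` sends every solution to the same line and is
injective. -/
theorem isMaximalSolution_newtonFlow (R lam0 : P.momentSpace) {T : EReal} (hT0 : 0 < T)
    (hT : ∀ t : ℝ, 0 ≤ t → ((t : EReal) < T ↔ decayLine R (P.kappa lam0) t ∈ range P.kappa)) :
    P.IsMaximalSolution R lam0 T (P.newtonFlow R lam0) := by
  refine ⟨hT0, ⟨?_, fun t ht htT => ?_⟩, fun T' mu ⟨hmu0, hmu⟩ => ?_⟩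
  · rw [newtonFlow, decayLine_zero]
    exact Function.leftInverse_invFun P.kappa_injective lam0
  · exact (hasDerivAt_invFun_decayLine P.hasStrictFDerivAt_kappa P.isUnit_nablaKappa
      P.kappa_injective ((hT t ht).1 htT)).hasDerivWithinAt
  · have hline : ∀ t : ℝ, 0 ≤ t → (t : EReal) < T' →
        P.kappa (mu t) = decayLine R (P.kappa lam0) t := fun t ht htT => by
      rw [← hmu0]
      exact eq_decayLine_of_newton_flow P.hasStrictFDerivAt_kappa P.isUnit_nablaKappa hmu ht htT
    refine ⟨?_, fun t ht htT => ?_⟩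
    -- A longer solution would keep the line in the range at some time beyond `T`.
    · by_contra! hlt
      obtain ⟨t, h1, h2⟩ := EReal.lt_iff_exists_real_btwn.1 hlt
      have ht : 0 ≤ t := by exact_mod_cast (hT0.trans h1).le
      exact lt_asymm h1 ((hT t ht).2 ⟨mu t, hline t ht h2⟩)
    · rw [newtonFlow, ← hline t ht htT]
      exact (Function.leftInverse_invFun P.kappa_injective (mu t)).symm

theorem hasDerivAt_norm_sub_decayLine_sq {E : Type*} [NormedAddCommGroup E] [NormedSpace ℝ E]
    (R y : E) (t : ℝ) : HasDerivAt (fun s => ‖R - decayLine R y s‖ ^ 2)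
      (-2 * ‖R - decayLine R y t‖ ^ 2) t := by
  have h : ∀ s, ‖R - decayLine R y s‖ ^ 2 = Real.exp (-2 * s) * ‖y - R‖ ^ 2 := fun s => by
    rw [decayLine, sub_add_cancel_left, norm_neg, norm_smul,
      Real.norm_of_nonneg (Real.exp_pos _).le, mul_pow, ← Real.exp_nat_mul]
    congr 2
    push_cast
    ring
  simp only [h]
  have h1 := (((hasDerivAt_id t).const_mul (-2 : ℝ)).exp).mul_const (‖y - R‖ ^ 2)
  refine h1.congr_deriv ?_
  simp only [id]
  ring

end MomentData

/-! ### Minimum entropy and the two regimes of the flow. -/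

theorem theorem5 {k m p q : ℕ} (P : MomentData k m p q) (R : P.momentSpace) :
    -- the entropy and the differential equation are well defined
    (∀ ρ ∈ P.conePos, IntegrableOn (P.entropyDensity ρ) P.S) ∧
    (∀ lam : P.momentSpace, IsUnit (P.nablaKappa lam) ∧
      HasFDerivAt P.kappa (LinearMap.toContinuousLinearMap (P.nablaKappa lam)) lam) ∧
    (R ∈ interior P.K →
      ∃ lamHat : P.momentSpace,
        -- the minimum exists, has the exponential form and is unique
        P.rhoExp lamHat ∈ P.conePosR R ∧
        (∀ ρ ∈ P.conePosR R, P.entropy (P.rhoExp lamHat) ≤ P.entropy ρ) ∧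
        (∀ ρ ∈ P.conePosR R, P.entropy ρ ≤ P.entropy (P.rhoExp lamHat) →
          ρ.1 =ᵐ[volume.restrict P.S] (P.rhoExp lamHat).1) ∧
        -- all trajectories are global, bounded and converge exponentially
        ∀ lam0 : P.momentSpace, ∃ lam : ℝ → P.momentSpace,
          P.IsMaximalSolution R lam0 ⊤ lam ∧
          (∃ B : ℝ, ∀ t : ℝ, 0 ≤ t → ‖lam t‖ ≤ B) ∧
          Tendsto lam atTop (𝓝 lamHat) ∧
          (∃ C : ℝ, ∀ t : ℝ, 0 ≤ t → ‖lam t - lamHat‖ ≤ C * Real.exp (-t)) ∧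
          (∀ t : ℝ, 0 ≤ t →
            HasDerivWithinAt (fun s => ‖R - P.kappa (lam s)‖ ^ 2)
              (-2 * ‖R - P.kappa (lam t)‖ ^ 2) (Ici 0) t)) ∧
    (R ∉ interior P.K →
      -- the maximal solution blows up at the end of its (finite or infinite) interval
      ∀ lam0 : P.momentSpace, ∃ (T : EReal) (lam : ℝ → P.momentSpace),
        P.IsMaximalSolution R lam0 T lam ∧
        ∀ B : ℝ, ∃ t₀ : ℝ, (t₀ : EReal) < T ∧
          ∀ t : ℝ, 0 ≤ t → t₀ ≤ t → (t : EReal) < T → B < ‖lam t‖) := by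
  refine ⟨fun ρ hρ => P.integrableOn_entropyDensity hρ, fun lam => ⟨P.isUnit_nablaKappa lam,
    (P.hasStrictFDerivAt_kappa lam).hasFDerivAt⟩, fun hR => ?_, fun hR lam0 => ?_⟩
  · rw [← P.range_kappa] at hR
    -- The multiplier is the preimage of `R` under `κ`; since `L ρ = R` is fixed, zero duality gap
    -- at `rhoExp lamHat` gives optimality and uniqueness.
    obtain ⟨lamHat, rfl⟩ := hR
    have hopt := P.entropy_rhoExp_add lamHat
    refine ⟨lamHat, ⟨P.rhoExp_mem_conePos lamHat, rfl⟩, fun ρ hρ => ?_, fun ρ hρ hle => ?_,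
      fun lam0 => ?_⟩
    · have h := P.entropy_add_nonneg hρ.1 lamHat
      rw [hρ.2] at h
      linarith
    · refine P.ae_eq_rhoExp hρ.1 lamHat ?_
      rw [hρ.2]
      linarith
    · have hconv : Convex ℝ (range P.kappa) := P.range_kappa ▸ P.convex_K.interior
      have hmem : ∀ t : ℝ, 0 ≤ t →
          decayLine (P.kappa lamHat) (P.kappa lam0) t ∈ range P.kappa := fun t ht =>
        decayLine_mem hconv (mem_range_self _) (mem_range_self _) ht
      obtain ⟨C, hC0, hC⟩ := norm_invFun_decayLine_sub_le P.hasStrictFDerivAt_kappa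
        P.isUnit_nablaKappa P.kappa_injective lamHat hmem
      refine ⟨P.newtonFlow (P.kappa lamHat) lam0, P.isMaximalSolution_newtonFlow _ _
        EReal.zero_lt_top fun t ht => ⟨fun _ => hmem t ht, fun _ => EReal.coe_lt_top t⟩,
        ⟨C + ‖lamHat‖, fun t ht => ?_⟩, ?_, ⟨C, hC⟩, fun t ht => ?_⟩
      · have h1 := norm_le_norm_sub_add (P.newtonFlow (P.kappa lamHat) lam0 t) lamHat
        have h2 := (hC t ht).trans
          (mul_le_of_le_one_right hC0 (Real.exp_le_one_iff.2 (by linarith)))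
        exact h1.trans (add_le_add_left h2 _)
      · refine tendsto_iff_norm_sub_tendsto_zero.2 ?_
        have h0 : Tendsto (fun t : ℝ => C * Real.exp (-t)) atTop (𝓝 0) := by
          simpa using Real.tendsto_exp_neg_atTop_nhds_zero.const_mul C
        refine squeeze_zero' (Eventually.of_forall fun _ => norm_nonneg _) ?_ h0
        filter_upwards [eventually_ge_atTop 0] with t ht
        exact hC t ht
      · have hk : ∀ s : ℝ, 0 ≤ s → P.kappa (P.newtonFlow (P.kappa lamHat) lam0 s) =
            decayLine (P.kappa lamHat) (P.kappa lam0) s := fun s hs =>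
          Function.invFun_eq (hmem s hs)
        rw [hk t ht]
        refine (MomentData.hasDerivAt_norm_sub_decayLine_sq _ _ t).hasDerivWithinAt.congr
          (fun s hs => ?_) ?_
        · rw [hk s hs]
        · rw [hk t ht]
  · rw [← P.range_kappa] at hR
    obtain ⟨T, hT0, hT⟩ := exists_exit_time (U := range P.kappa)
      (P.range_kappa ▸ P.convex_K.interior) (P.range_kappa ▸ isOpen_interior) R
      (mem_range_self lam0)
    exact ⟨T, P.newtonFlow R lam0, P.isMaximalSolution_newtonFlow R lam0 hT0 hT,
      norm_invFun_decayLine_unbounded (continuous_iff_continuousAt.2 fun x =>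
        (P.hasStrictFDerivAt_kappa x).continuousAt) hR hT0 hT⟩
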